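/- **Setting.** Let $S$ be a countable set, $p$ a stochastic kernel on $S$, $\beta$ a probability measure on $S$, and let $(X_n)_{n\ge1}$ be a Markov chain on $S$ with initial law $\beta$ and kernel $p$, defined on a probability space with probability $\mathbb P$. Let $\mathcal P(S^2)$ be the set of probability measures on $S^2$, with total variation open balls $\mathcal B(\mu,r)$, and let $L_n=\frac1n\sum_{k=1}^n\delta_{(X_k,X_{k+1})}$. *Admissibility.* Write $x\leadsto y$ if there is a path $x=x_1,\dots,x_{n+1}=y$ with $n\ge1$ and $p(x_i,x_{i+1})>0$ for all $1\le i\le n$. The irreducible classes $(C_j)_{j\in\mathcal J}$ are the maximal nonempty sets $C\subseteq S$ such that $x\leadsto y$ for all $x,y\in C$. Write $C_i\leadsto C_j$ if $x\leadsto y$ for some $x\in C_i$, $y\in C_j$, and $\beta\leadsto C_j$ if some $y\in C_j$ satisfies $\beta(y)>0$ or $x\leadsto y$ for some $x$ with $\beta(x)>0$. A measure $\mu\in\mathcal P(S^2)$ is pre-admissible if $\mu=\sum_{j\in \mathcal J_\mu}\mu|_{C_j^2}$ for some $\mathcal J_\mu\subseteq\mathcal J$, and $\mathcal J_\mu$ then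 denotes the minimal such set. It is admissible if moreover $\leadsto$ is total on $(C_j)_{j\in\mathcal J_\mu}$ and $\beta\leadsto C_j$ for all $j\in\mathcal J_\mu$. Let $\mathcal A^{(2)}$ be the set of admissible measures and $\mathcal A^{(2)}_{\mathrm{bal}}$ the set of those $\mu\in\mathcal A^{(2)}$ with $\mu(A\times S)=\mu(S\times A)$ for all $A\subseteq S$. *Rate function.* For $A\subseteq\mathcal P(S^2)$ let $\underline s(A)=\liminf_n\frac1n\log\mathbb P(L_n\in A)$ and $\overline s(A)=\limsup_n\frac1n\log\mathbb P(L_n\in A)$ (with $\log 0=-\infty$). For $\nu\in\mathcal P(S^2)$ let $\underline s(\nu)=\lim_{\delta\downarrow0}\underline s(\mathcal B(\nu,\delta))$ and $\overline s(\nu)=\lim_{\delta\downarrow0}\overline s(\mathcal B(\nu,\delta))$ (monotone limits). **Proposition.** One has $\underline s(\nu)=\overline s(\nu)=:s(\nu)$ for all $\nu\in\mathcal P(S^2)$, and the rate function $I^{(2)}:=-s$ has the following properties (with the convention $0\cdot\infty=0$). 1. Let $\mu\in\mathcal A^{(2)}$ and $\mathcal F=\{\nu\in\mathcal A^{(2)}:\mathcal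 J_\nu\subseteq\mathcal J_\mu\}$. Then $\mathcal F$ is convex and $I^{(2)}|_{\mathcal F}$ is convex. In particular, if $\lambda_1\in[0,1]$, $\lambda_2=1-\lambda_1$, and $\mu_1,\mu_2\in\mathcal A^{(2)}$ satisfy $\lambda_1\mu_1+\lambda_2\mu_2\in\mathcal A^{(2)}$, then $$I^{(2)}(\lambda_1\mu_1+\lambda_2\mu_2)\le\lambda_1I^{(2)}(\mu_1)+\lambda_2I^{(2)}(\mu_2).$$ 2. Let $\lambda_1\in[0,1]$, $\lambda_2=1-\lambda_1$, and let $\mu_1,\mu_2\in\mathcal A^{(2)}$ satisfy $\lambda_1\mu_1+\lambda_2\mu_2\in\mathcal A^{(2)}$ and $\mathcal J_{\mu_1}\cap\mathcal J_{\mu_2}=\emptyset$. Then $$I^{(2)}(\lambda_1\mu_1+\lambda_2\mu_2)=\lambda_1I^{(2)}(\mu_1)+\lambda_2I^{(2)}(\mu_2).$$ 3. If $\mu\in\mathcal P(S^2)\setminus\mathcal A^{(2)}_{\mathrm{bal}}$, then $I^{(2)}(\mu)=\infty$. 4. For $A\subseteq\mathcal P(S^2)$ let $\underline s_\infty(A)$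 be the supremum, over all finite $K\subseteq S$, of $\underline s(A\cap\mathcal P(K^2))$, where $\mathcal P(K^2)$ is the set of $\nu\in\mathcal P(S^2)$ whose support is contained in $K^2$. Let $\mu\in\mathcal P(S^2)$. Then $r\mapsto\underline s_\infty(\mathcal B(\mu,r))$ is nondecreasing on $(0,\infty)$ and $$I^{(2)}(\mu)=-\lim_{r\downarrow0}\underline s_\infty(\mathcal B(\mu,r)).$$ -/

import Mathlib

open MeasureTheory Set Filter Topology
open scoped ENNReal NNReal

noncomputable section

namespace PairLDP

section Classes

variable {S : Type*}

/-- `y` is reachable from `x`: there is a path of positive probability with at least one step. -/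
def Reach (p : S → PMF S) : S → S → Prop :=
  Relation.TransGen fun x y => p x y ≠ 0

/-- Irreducible classes: the maximal nonempty sets all of whose points reach each other
(and themselves). -/
def IsIrredClass (p : S → PMF S) (C : Set S) : Prop :=
  Maximal (fun D : Set S => D.Nonempty ∧ ∀ x ∈ D, ∀ y ∈ D, Reach p x y) C

/-- The class `D` is reachable from the class `C`. -/
def ClassReach (p : S → PMF S) (C D : Set S) : Prop :=
  ∃ x ∈ C, ∃ y ∈ D, Reach p x y

/-- The class `C` is reachable from the initial distribution `β`. -/
def InitReach (p : S → PMF S) (β : PMF S) (C : Set S) : Prop :=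
  ∃ y ∈ C, y ∈ β.support ∨ ∃ x ∈ β.support, Reach p x y

theorem IsIrredClass.eq_of_mem {p : S → PMF S} {C D : Set S} (hC : IsIrredClass p C)
    (hD : IsIrredClass p D) {x : S} (hxC : x ∈ C) (hxD : x ∈ D) : C = D := by
  have hU : (C ∪ D).Nonempty ∧ ∀ a ∈ C ∪ D, ∀ b ∈ C ∪ D, Reach p a b := by
    refine ⟨⟨x, Or.inl hxC⟩, ?_⟩
    have h1 : ∀ a ∈ C ∪ D, Reach p a x ∧ Reach p x a := by
      rintro a (ha | ha)
      · exact ⟨hC.prop.2 a ha x hxC, hC.prop.2 x hxC a ha⟩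
      · exact ⟨hD.prop.2 a ha x hxD, hD.prop.2 x hxD a ha⟩
    intro a ha b hb
    exact Relation.TransGen.trans (h1 a ha).1 (h1 b hb).2
  exact (hC.eq_of_subset hU subset_union_left).trans
    (hD.eq_of_subset hU subset_union_right).symm

variable [MeasurableSpace S]

/-- `μ` is the sum of its restrictions to the squares `C × C`, for `C` in the set `J` of
irreducible classes. -/
def DecomposesAlong (p : S → PMF S) (μ : Measure (S × S)) (J : Set (Set S)) : Prop :=
  (∀ C ∈ J, IsIrredClass p C) ∧ μ = Measure.sum fun C : J => μ.restrict ((C : Set S) ×ˢ (C : Set S))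

/-- Pre-admissible measures. -/
def PreAdmissible (p : S → PMF S) (μ : Measure (S × S)) : Prop :=
  ∃ J, DecomposesAlong p μ J

/-- The set of irreducible classes charged by `μ`. For a pre-admissible `μ` it is the minimal
set of classes along which `μ` decomposes, see `isLeast_chargedClasses`. -/
def chargedClasses (p : S → PMF S) (μ : Measure (S × S)) : Set (Set S) :=
  {C | IsIrredClass p C ∧ μ (C ×ˢ C) ≠ 0}

theorem isLeast_chargedClasses [Countable S] [MeasurableSingletonClass S] {p : S → PMF S}
    {μ : Measure (S × S)} (h : PreAdmissible p μ) :
    IsLeast {J | DecomposesAlong p μ J} (chargedClasses p μ) := by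
  have key : ∀ J, DecomposesAlong p μ J → chargedClasses p μ ⊆ J := by
    intro J hJ C hC
    by_contra hCJ
    apply hC.2
    rw [hJ.2, Measure.sum_apply _ (Set.to_countable _).measurableSet]
    refine ENNReal.tsum_eq_zero.2 fun D => ?_
    rw [Measure.restrict_apply (Set.to_countable _).measurableSet]
    have : (C ×ˢ C) ∩ ((D : Set S) ×ˢ (D : Set S)) = ∅ := by
      ext z
      simp only [mem_inter_iff, mem_prod, mem_empty_iff_false, iff_false]
      rintro ⟨⟨h1, -⟩, h2, -⟩
      exact hCJ (hC.1.eq_of_mem (hJ.1 D D.2) h1 h2 ▸ D.2)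
    rw [this, measure_empty]
  refine ⟨⟨fun C hC => hC.1, ?_⟩, key⟩
  obtain ⟨J, hJ⟩ := h
  refine Measure.ext fun A hA => ?_
  conv_lhs => rw [hJ.2]
  rw [Measure.sum_apply _ hA, Measure.sum_apply _ hA,
    tsum_subtype J (fun C : Set S => μ.restrict (C ×ˢ C) A),
    tsum_subtype (chargedClasses p μ) (fun C : Set S => μ.restrict (C ×ˢ C) A)]
  refine tsum_congr fun C => ?_
  by_cases h1 : C ∈ chargedClasses p μ
  · rw [indicator_of_mem h1, indicator_of_mem (key J hJ h1)]
  · rw [indicator_of_notMem h1]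
    by_cases h2 : C ∈ J
    · have h0 : μ (C ×ˢ C) = 0 := by
        by_contra h3
        exact h1 ⟨hJ.1 C h2, h3⟩
      rw [indicator_of_mem h2, Measure.restrict_eq_zero.2 h0]
      rfl
    · rw [indicator_of_notMem h2]

/-- The set of admissible probability measures on `S × S`: pre-admissible measures whose
charged classes are totally ordered by reachability and all reachable from `β`. -/
def admissible (p : S → PMF S) (β : PMF S) : Set (Measure (S × S)) :=
  {μ | IsProbabilityMeasure μ ∧ PreAdmissible p μ ∧
    (∀ C ∈ chargedClasses p μ, ∀ D ∈ chargedClasses p μ, ClassReach p C D ∨ ClassReach p D C) ∧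
    ∀ C ∈ chargedClasses p μ, InitReach p β C}

/-- The set of admissible probability measures whose two marginals are equal. -/
def admissibleBal (p : S → PMF S) (β : PMF S) : Set (Measure (S × S)) :=
  {μ ∈ admissible p β | ∀ A : Set S, μ (A ×ˢ univ) = μ (univ ×ˢ A)}

end Classes

section Chain

variable {S Ω : Type*} [MeasurableSpace S] [MeasurableSpace Ω]

/-- Under `P`, the process `X` is a Markov chain with initial distribution `β` and transition
kernel `p` (time starts at `0`). -/
def IsMarkovChain (p : S → PMF S) (β : PMF S) (P : Measure Ω) (X : ℕ → Ω → S) : Prop :=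
  (∀ n, Measurable (X n)) ∧
    ∀ (n : ℕ) (u : ℕ → S),
      P {ω | ∀ i ≤ n, X i ω = u i} = β (u 0) * ∏ i ∈ Finset.range n, p (u i) (u (i + 1))

/-- The pair empirical measure of the first `n` transitions (a probability measure if
`1 ≤ n`). -/
def pairEmp (X : ℕ → Ω → S) (n : ℕ) (ω : Ω) : Measure (S × S) :=
  (n : ℝ≥0∞)⁻¹ • ∑ k ∈ Finset.range n, Measure.dirac (X k ω, X (k + 1) ω)

/-- The total variation distance between probability measures on the countable discrete space
`S × S`: half of the `ℓ¹` distance. -/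
def tvDist (μ ν : Measure (S × S)) : ℝ :=
  (∑' z : S × S, |μ.real {z} - ν.real {z}|) / 2

/-- The open total variation ball in the space of probability measures on `S × S`. -/
def tvBall (μ : Measure (S × S)) (r : ℝ) : Set (Measure (S × S)) :=
  {ν | IsProbabilityMeasure ν ∧ tvDist μ ν < r}

/-- The set of probability measures on `S × S` with support in `K × K`. -/
def probOn (K : Set S) : Set (Measure (S × S)) :=
  {ν | IsProbabilityMeasure ν ∧ {z | ν {z} ≠ 0} ⊆ K ×ˢ K}

/-- `liminf (1/n) log P(Lₙ ∈ A)`, with `log 0 = -∞`. -/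
def sLow (P : Measure Ω) (X : ℕ → Ω → S) (A : Set (Measure (S × S))) : EReal :=
  liminf (fun n : ℕ => ENNReal.log (P {ω | pairEmp X n ω ∈ A}) / (n : EReal)) atTop

/-- `limsup (1/n) log P(Lₙ ∈ A)`, with `log 0 = -∞`. -/
def sUpp (P : Measure Ω) (X : ℕ → Ω → S) (A : Set (Measure (S × S))) : EReal :=
  limsup (fun n : ℕ => ENNReal.log (P {ω | pairEmp X n ω ∈ A}) / (n : EReal)) atTop

/-- The lower Ruelle-Lanford function: the monotone limit, as `δ` decreases to `0`, of `sLow` of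
the ball of radius `δ`. -/
def rlLow (P : Measure Ω) (X : ℕ → Ω → S) (ν : Measure (S × S)) : EReal :=
  ⨅ δ : Ioi (0 : ℝ), sLow P X (tvBall ν δ)

/-- The upper Ruelle-Lanford function: the monotone limit, as `δ` decreases to `0`, of `sUpp` of
the ball of radius `δ`. -/
def rlUpp (P : Measure Ω) (X : ℕ → Ω → S) (ν : Measure (S × S)) : EReal :=
  ⨅ δ : Ioi (0 : ℝ), sUpp P X (tvBall ν δ)

/-- The rate function: minus the (lower) Ruelle-Lanford function. -/
def rateI (P : Measure Ω) (X : ℕ → Ω → S) (ν : Measure (S × S)) : EReal :=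
  -rlLow P X ν

/-- The supremum over finite `K ⊆ S` of the lower rates of `A` truncated to measures supported
in `K × K`. -/
def sLowFin (P : Measure Ω) (X : ℕ → Ω → S) (A : Set (Measure (S × S))) : EReal :=
  ⨆ K : Finset S, sLow P X (A ∩ probOn (K : Set S))

theorem tvBall_mono (μ : Measure (S × S)) : Monotone (tvBall μ) :=
  fun _ _ h _ hν => ⟨hν.1, hν.2.trans_le h⟩

theorem log_div_mono (P : Measure Ω) (X : ℕ → Ω → S) {A B : Set (Measure (S × S))} (h : A ⊆ B)
    (n : ℕ) : ENNReal.log (P {ω | pairEmp X n ω ∈ A}) / (n : EReal) ≤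
      ENNReal.log (P {ω | pairEmp X n ω ∈ B}) / (n : EReal) :=
  EReal.div_le_div_right_of_nonneg (by positivity)
    (ENNReal.log_monotone (measure_mono fun _ hω => h hω))

theorem tendsto_rlLow (P : Measure Ω) (X : ℕ → Ω → S) (ν : Measure (S × S)) :
    Tendsto (fun δ : ℝ => sLow P X (tvBall ν δ)) (𝓝[>] 0) (𝓝 (rlLow P X ν)) := by
  have hm : Monotone fun δ : ℝ => sLow P X (tvBall ν δ) := fun a b hab =>
    liminf_le_liminf (.of_forall (log_div_mono P X (tvBall_mono ν hab)))
  have := hm.tendsto_nhdsGT 0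
  rwa [sInf_image'] at this

theorem tendsto_rlUpp (P : Measure Ω) (X : ℕ → Ω → S) (ν : Measure (S × S)) :
    Tendsto (fun δ : ℝ => sUpp P X (tvBall ν δ)) (𝓝[>] 0) (𝓝 (rlUpp P X ν)) := by
  have hm : Monotone fun δ : ℝ => sUpp P X (tvBall ν δ) := fun a b hab =>
    limsup_le_limsup (.of_forall (log_div_mono P X (tvBall_mono ν hab)))
  have := hm.tendsto_nhdsGT 0
  rwa [sInf_image'] at this

end Chain

end PairLDP

end

open PairLDP

/-! The rate function is computed explicitly. The event that the pair empirical measure is near `μ`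
says that the transition counts of the observed path are ℓ¹-close to `n • μ`, so only weights of
finite paths matter. For an irreducible class with base point `o`, `loopRate p o ν` is the least
exponential rate at which families of loops at `o`, inside a finite set for each precision, produce
counts close to `N • ν` for all `N`. Concatenating loops makes this cost subadditive, and rescaling
`N` makes it positively homogeneous. The claim is that on admissible measures the rate function
equals `classRateSum`, the sum over all classes of the costs of the restrictions of `μ`.

Lower bound (`neg_classRateSum_le_sLowFin`): finitely many charged classes carry almost all the
mass. Being totally ordered by reachability and reachable from `β`, they can be visited one after
the other; the connecting paths have bounded length and cost, hence are free on the exponential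
scale. All these paths live in a finite set, so the bound already holds for the truncated rates
`sLowFin`.

Upper bound (`rlUpp_le_neg_classRateSum`): a possible path cannot return to a class after leaving
it. A path with counts near `n • μ` therefore splits into consecutive pieces, one per class, each
starting and ending in a finite part of its class (`exists_closePaths`), and the probability is a
product up to a polynomial factor (`pathMass_le_prod`). Each factor is exponentially small at any
rate below the loop cost: otherwise the pieces, closed up through the base point, would be loops
that are too cheap (`eventually_closePaths_le`).

Outside the balanced admissible measures small balls have probability zero for large `n`
(`mem_admissibleBal_of_approx`): a repeated transition lies on a cycle, the states of one path are
comparable, and a path enters and leaves a set equally often up to one.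

Since the upper bound matches a lower bound for truncated rates, the lower, upper and truncated
limits coincide. Convexity comes from subadditivity and homogeneity of the cost, and affinity from
the fact that each class sees only one of the two measures. -/

noncomputable section

namespace PairLDP

/-! ### The space of summable families and restriction to a set of indices. -/

section SummableFamilies

/-- Absolutely summable real families. -/
abbrev L1 (ι : Type*) : Type _ := lp (fun _ : ι => ℝ) 1

variable {ι : Type*}

theorem L1.hasSum_abs (f : L1 ι) : HasSum (fun z => |f z|) ‖f‖ := by
  have := lp.hasSum_norm (p := 1) (by simp) f
  simpa using this

theorem L1.norm_eq (f : L1 ι) : ‖f‖ = ∑' z, |f z| := (L1.hasSum_abs f).tsum_eq.symm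

theorem L1.norm_mono {f g : L1 ι} (h : ∀ z, |f z| ≤ |g z|) : ‖f‖ ≤ ‖g‖ :=
  hasSum_le h (L1.hasSum_abs f) (L1.hasSum_abs g)

theorem L1.norm_add_of_nonneg {f g : L1 ι} (hf : ∀ z, 0 ≤ f z) (hg : ∀ z, 0 ≤ g z) :
    ‖f + g‖ = ‖f‖ + ‖g‖ := by
  have h : (fun z => |(f + g) z|) = fun z => |f z| + |g z| := by
    ext z
    rw [lp.coeFn_add, Pi.add_apply, abs_of_nonneg (hf z), abs_of_nonneg (hg z),
      abs_of_nonneg (add_nonneg (hf z) (hg z))]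
  exact (L1.hasSum_abs (f + g)).unique (h ▸ (L1.hasSum_abs f).add (L1.hasSum_abs g))

theorem L1.memℓp_of_le {f : ι → ℝ} {g : ι → ℝ} (hg : Summable g) (h : ∀ z, |f z| ≤ g z) :
    Memℓp f 1 := by
  refine memℓp_gen ?_
  simpa using Summable.of_nonneg_of_le (fun z => abs_nonneg (f z)) h hg

/-- Restriction of a summable family to a set of indices. -/
def res (A : Set ι) : L1 ι →ₗ[ℝ] L1 ι where
  toFun f := ⟨A.indicator f, L1.memℓp_of_le (L1.hasSum_abs f).summable fun z => by
    by_cases hz : z ∈ A <;> simp [hz]⟩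
  map_add' f g := by
    ext z
    change A.indicator (⇑f + ⇑g) z = A.indicator f z + A.indicator g z
    rw [indicator_add', Pi.add_apply]
  map_smul' c f := by
    ext z
    by_cases hz : z ∈ A <;> simp [lp.coeFn_smul, indicator]

theorem res_apply (A : Set ι) (f : L1 ι) (z : ι) : res A f z = A.indicator f z := rfl

theorem norm_res_le (A : Set ι) (f : L1 ι) : ‖res A f‖ ≤ ‖f‖ :=
  L1.norm_mono fun z => by by_cases hz : z ∈ A <;> simp [res_apply, hz]

theorem res_res (A B : Set ι) (f : L1 ι) : res A (res B f) = res (A ∩ B) f := by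
  ext z
  by_cases hz : z ∈ A <;> by_cases hz' : z ∈ B <;> simp [res_apply, hz, hz']

theorem res_eq_self {A : Set ι} {f : L1 ι} (h : ∀ z, f z ≠ 0 → z ∈ A) : res A f = f := by
  ext z
  by_cases hz : z ∈ A
  · simp [res_apply, hz]
  · simpa [res_apply, hz, eq_comm] using not_imp_not.2 (h z) hz

theorem res_eq_zero {A : Set ι} {f : L1 ι} (h : ∀ z ∈ A, f z = 0) : res A f = 0 := by
  ext z
  by_cases hz : z ∈ A
  · simp [res_apply, hz, h z hz]
  · simp [res_apply, hz]

theorem res_union {A B : Set ι} (h : Disjoint A B) (f : L1 ι) :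
    res (A ∪ B) f = res A f + res B f := by
  ext z
  simp [res_apply, indicator_union_of_disjoint h]

theorem sub_res (A : Set ι) (f : L1 ι) : f - res A f = res Aᶜ f := by
  ext z
  by_cases hz : z ∈ A <;> simp [res_apply, hz]

theorem res_nonneg {A : Set ι} {f : L1 ι} (hf : ∀ z, 0 ≤ f z) (z : ι) : 0 ≤ res A f z := by
  rw [res_apply]
  exact indicator_nonneg (fun z _ => hf z) z

/-- The family `f` is determined up to a small error by finitely many entries. -/
theorem exists_finset_norm_sub_res_le (f : L1 ι) {ε : ℝ} (hε : 0 < ε) :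
    ∃ F : Finset ι, ∀ A : Set ι, (∀ z ∈ F, f z ≠ 0 → z ∈ A) → ‖f - res A f‖ ≤ ε := by
  classical
  have h := lp.hasSum_single (p := 1) (by simp) f
  obtain ⟨F, hF⟩ := ((h.eventually (Metric.ball_mem_nhds f hε))).exists
  refine ⟨F, fun A hA => ?_⟩
  have h0 : res Aᶜ (∑ i ∈ F, lp.single 1 i (f i)) = 0 := by
    rw [map_sum]
    refine Finset.sum_eq_zero fun i hi => res_eq_zero fun z hz => ?_
    rw [lp.single_apply]
    by_cases hzi : z = i
    · subst hzi
      by_contra h1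
      exact hz (hA z hi (by simpa using h1))
    · simp [hzi]
  -- The finite approximation lives on `A`, so removing it does not change the part of `f` outside
  -- `A`, and what is left has small norm.
  have h1 : res Aᶜ f = res Aᶜ (f - ∑ i ∈ F, lp.single 1 i (f i)) := by
    rw [map_sub, h0, sub_zero]
  rw [sub_res, h1]
  refine (norm_res_le _ _).trans ?_
  rw [← dist_eq_norm, dist_comm]
  exact hF.le

end SummableFamilies

/-! ### Finite paths: weight, end point, transition counts, and irreducible classes. -/

section Paths

variable {S : Type*}

/-- The probability of the path that starts at `x` and then visits the states in the list. -/
def pathWt (p : S → PMF S) : S → List S → ℝ≥0∞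
  | _, [] => 1
  | x, y :: l => p x y * pathWt p y l

/-- The last state of a path. -/
def pathEnd : S → List S → S
  | x, [] => x
  | _, y :: l => pathEnd y l

open Classical in
/-- The number of transitions of each kind on a path. -/
def pathCnt : S → List S → L1 (S × S)
  | _, [] => 0
  | x, y :: l => lp.single 1 (x, y) 1 + pathCnt y l

variable {p : S → PMF S}

@[simp] theorem pathWt_nil (x : S) : pathWt p x [] = 1 := rfl
@[simp] theorem pathWt_cons (x y : S) (l : List S) :
    pathWt p x (y :: l) = p x y * pathWt p y l := rfl
@[simp] theorem pathEnd_nil (x : S) : pathEnd x [] = x := rfl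
@[simp] theorem pathEnd_cons (x y : S) (l : List S) : pathEnd x (y :: l) = pathEnd y l := rfl
@[simp] theorem pathCnt_nil (x : S) : pathCnt x [] = 0 := rfl
open Classical in
theorem pathCnt_cons (x y : S) (l : List S) :
    pathCnt x (y :: l) = lp.single 1 (x, y) 1 + pathCnt y l := rfl

open Classical in
theorem pathCnt_cons_apply (x y : S) (l : List S) (z : S × S) :
    pathCnt x (y :: l) z = (if z = (x, y) then 1 else 0) + pathCnt y l z := by
  rw [pathCnt_cons, lp.coeFn_add, Pi.add_apply, lp.single_apply]
  simp [Pi.single_apply]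

theorem pathWt_append (x : S) (l l' : List S) :
    pathWt p x (l ++ l') = pathWt p x l * pathWt p (pathEnd x l) l' := by
  induction l generalizing x with
  | nil => simp
  | cons y l ih => simp [ih, mul_assoc]

theorem pathEnd_append (x : S) (l l' : List S) :
    pathEnd x (l ++ l') = pathEnd (pathEnd x l) l' := by
  induction l generalizing x with
  | nil => simp
  | cons y l ih => simp [ih]

theorem pathCnt_append (x : S) (l l' : List S) :
    pathCnt x (l ++ l') = pathCnt x l + pathCnt (pathEnd x l) l' := by
  induction l generalizing x with
  | nil => simp
  | cons y l ih => simp [ih, pathCnt_cons, add_assoc]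

theorem pathCnt_nonneg (x : S) (l : List S) (z : S × S) : 0 ≤ pathCnt x l z := by
  induction l generalizing x with
  | nil => simp
  | cons y l ih =>
    rw [pathCnt_cons_apply]
    exact add_nonneg (by split_ifs <;> norm_num) (ih y)

/-- Counts are nonnegative, so the ℓ¹ norm adds up over the transitions. Through this identity,
control of the counts is also control of the length. -/
theorem norm_pathCnt (x : S) (l : List S) : ‖pathCnt x l‖ = l.length := by
  classical
  induction l generalizing x with
  | nil => simp
  | cons y l ih =>
    rw [pathCnt_cons, L1.norm_add_of_nonneg, ih, lp.norm_single (by simp)]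
    · simp [add_comm]
    · intro z
      simp only [lp.single_apply, Pi.single_apply]
      split_ifs <;> norm_num
    · exact pathCnt_nonneg y l

/-- The transitions of a path through states in `K` lie in `K × K`. -/
theorem pathCnt_ne_zero_mem {K : Set S} {x : S} {l : List S} (hx : x ∈ K) (hl : ∀ y ∈ l, y ∈ K)
    {z : S × S} (hz : pathCnt x l z ≠ 0) : z ∈ K ×ˢ K := by
  induction l generalizing x with
  | nil => simp at hz
  | cons y l ih =>
    rw [pathCnt_cons_apply] at hz
    have hy := hl y (by simp)
    split_ifs at hz with h
    · subst h
      exact ⟨hx, hy⟩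
    · exact ih hy (fun w hw => hl w (by simp [hw])) (by simpa using hz)

theorem pathWt_le_one (x : S) (l : List S) : pathWt p x l ≤ 1 := by
  induction l generalizing x with
  | nil => simp
  | cons y l ih => simpa using mul_le_one' (PMF.coe_le_one _ _) (ih y)

theorem reach_pathEnd {x : S} {l : List S} (hl : l ≠ []) (hw : pathWt p x l ≠ 0) :
    Reach p x (pathEnd x l) := by
  induction l generalizing x with
  | nil => simp at hl
  | cons y l ih =>
    rw [pathWt_cons, mul_ne_zero_iff] at hw
    rcases eq_or_ne l [] with rfl | h
    · exact Relation.TransGen.single hw.1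
    · exact Relation.TransGen.head hw.1 (ih h hw.2)

theorem Reach.exists_path {x y : S} (h : Reach p x y) :
    ∃ l : List S, l ≠ [] ∧ pathEnd x l = y ∧ pathWt p x l ≠ 0 := by
  induction h with
  | @single b h => exact ⟨[b], by simp, by simp, by simpa using h⟩
  | @tail b c _ h ih =>
    obtain ⟨l, hl, he, hw⟩ := ih
    refine ⟨l ++ [c], by simp, by simp [pathEnd_append], ?_⟩
    rw [pathWt_append, he]
    simpa using ⟨hw, h⟩

theorem IsIrredClass.reach {C : Set S} (hC : IsIrredClass p C) {x y : S} (hx : x ∈ C)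
    (hy : y ∈ C) : Reach p x y := hC.prop.2 x hx y hy

/-- Adjoining `y` to the class keeps all its points mutually reachable, so maximality forces `y` to
be in it already. -/
theorem IsIrredClass.mem_of_reach {C : Set S} (hC : IsIrredClass p C) {x y z : S} (hx : x ∈ C)
    (hz : z ∈ C) (hxy : Reach p x y) (hyz : Reach p y z) : y ∈ C := by
  have hU : (insert y C).Nonempty ∧ ∀ a ∈ insert y C, ∀ b ∈ insert y C, Reach p a b := by
    have h1 : ∀ a ∈ insert y C, Reach p a y ∧ Reach p y a := by
      rintro a (rfl | ha)
      · exact ⟨hyz.trans ((hC.reach hz hx).trans hxy), hyz.trans ((hC.reach hz hx).trans hxy)⟩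
      · exact ⟨(hC.reach ha hx).trans hxy, hyz.trans (hC.reach hz ha)⟩
    exact ⟨⟨y, by simp⟩, fun a ha b hb => (h1 a ha).1.trans (h1 b hb).2⟩
  rw [hC.eq_of_subset hU (subset_insert y C)]
  exact mem_insert y C

/-- Two states that reach each other belong to an irreducible class. -/
theorem exists_class {x y : S} (hxy : Reach p x y) (hyx : Reach p y x) :
    ∃ C, IsIrredClass p C ∧ x ∈ C ∧ y ∈ C := by
  refine ⟨{z | Reach p x z ∧ Reach p z x}, ⟨⟨⟨y, hxy, hyx⟩, ?_⟩, ?_⟩, ?_, hxy, hyx⟩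
  · exact fun a ha b hb => ha.2.trans hb.1
  · intro D hD hle a ha
    have hy : y ∈ D := hle ⟨hxy, hyx⟩
    exact ⟨hxy.trans (hD.2 y hy a ha), (hD.2 a ha y hy).trans hyx⟩
  · exact ⟨hxy.trans hyx, hxy.trans hyx⟩

/-- A path that can occur and that starts and ends in an irreducible class stays in it. -/
theorem IsIrredClass.path_mem {C : Set S} (hC : IsIrredClass p C) {x : S} {l : List S}
    (hx : x ∈ C) (he : pathEnd x l ∈ C) (hw : pathWt p x l ≠ 0) : ∀ y ∈ l, y ∈ C := by
  induction l generalizing x with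
  | nil => simp
  | cons y l ih =>
    rw [pathWt_cons, mul_ne_zero_iff] at hw
    have hy : y ∈ C := by
      rcases eq_or_ne l [] with rfl | h
      · simpa using he
      · exact hC.mem_of_reach hx he (Relation.TransGen.single hw.1) (reach_pathEnd h hw.2)
    intro z hz
    rcases List.mem_cons.1 hz with rfl | hz
    · exact hy
    · exact ih hy he hw.2 z hz

end Paths

/-! ### Families of paths, flows, and the cost of loops. -/

section Families

variable {S : Type*} {p : S → PMF S}

/-- There is a finite family of paths of length `m` from `x` to `y` through `K` whose transition
counts are `η`-close to `v` and whose total probability is at least `exp (-ρ)`. -/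
def HasPaths (p : S → PMF S) (K : Set S) (x y : S) (m : ℕ) (v : L1 (S × S)) (η ρ : ℝ) : Prop :=
  ∃ Γ : Finset (List S), (∀ l ∈ Γ, l.length = m ∧ pathEnd x l = y ∧ (∀ z ∈ l, z ∈ K) ∧
    ‖pathCnt x l - v‖ ≤ η) ∧ ENNReal.ofReal (Real.exp (-ρ)) ≤ ∑ l ∈ Γ, pathWt p x l

theorem HasPaths.mono {K K' : Set S} {x y : S} {m : ℕ} {v v' : L1 (S × S)} {η η' ρ ρ' : ℝ}
    (h : HasPaths p K x y m v η ρ) (hK : K ⊆ K') (hη : η + ‖v - v'‖ ≤ η') (hρ : ρ ≤ ρ') :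
    HasPaths p K' x y m v' η' ρ' := by
  obtain ⟨Γ, h1, h2⟩ := h
  refine ⟨Γ, fun l hl => ?_, le_trans (ENNReal.ofReal_le_ofReal ?_) h2⟩
  · obtain ⟨a, b, c, d⟩ := h1 l hl
    refine ⟨a, b, fun z hz => hK (c z hz), ?_⟩
    have := norm_sub_le_norm_sub_add_norm_sub (pathCnt x l) v v'
    linarith
  · exact Real.exp_le_exp.2 (by linarith)

theorem HasPaths.mono_set {K K' : Set S} {x y : S} {m : ℕ} {v : L1 (S × S)} {η ρ : ℝ}
    (h : HasPaths p K x y m v η ρ) (hK : K ⊆ K') : HasPaths p K' x y m v η ρ :=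
  h.mono hK (by simp) le_rfl

theorem HasPaths.comp {K : Set S} {x y z : S} {m m' : ℕ} {v v' : L1 (S × S)} {η η' ρ ρ' : ℝ}
    (h : HasPaths p K x y m v η ρ) (h' : HasPaths p K y z m' v' η' ρ') :
    HasPaths p K x z (m + m') (v + v') (η + η') (ρ + ρ') := by
  classical
  obtain ⟨Γ, h1, h2⟩ := h
  obtain ⟨Γ', h1', h2'⟩ := h'
  refine ⟨(Γ ×ˢ Γ').image fun q => q.1 ++ q.2, fun l hl => ?_, ?_⟩
  · obtain ⟨⟨l1, l2⟩, hmem, rfl⟩ := Finset.mem_image.1 hl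
    replace hl := Finset.mem_product.1 hmem
    obtain ⟨a, b, c, d⟩ := h1 l1 hl.1
    obtain ⟨a', b', c', d'⟩ := h1' l2 hl.2
    refine ⟨by simp [a, a'], by simp [pathEnd_append, b, b'], ?_, ?_⟩
    · intro w hw
      rcases List.mem_append.1 hw with hw | hw
      · exact c w hw
      · exact c' w hw
    · rw [pathCnt_append, b, add_sub_add_comm]
      exact (norm_add_le _ _).trans (add_le_add d d')
  · rw [Finset.sum_image, Finset.sum_product]
    · have : ∑ l ∈ Γ, ∑ l' ∈ Γ', pathWt p x (l ++ l')
          = (∑ l ∈ Γ, pathWt p x l) * ∑ l' ∈ Γ', pathWt p y l' := by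
        rw [Finset.sum_mul]
        refine Finset.sum_congr rfl fun l hl => ?_
        rw [Finset.mul_sum]
        refine Finset.sum_congr rfl fun l' _ => ?_
        rw [pathWt_append, (h1 l hl).2.1]
      rw [this, neg_add, Real.exp_add, ENNReal.ofReal_mul (Real.exp_pos _).le]
      exact mul_le_mul' h2 h2'
    -- Concatenation is injective here because all first pieces have the same length `m`; this is
    -- why a family prescribes an exact length.
    · rintro ⟨l1, l2⟩ hl ⟨l3, l4⟩ hl' heq
      simp only [Finset.coe_product, mem_prod, Finset.mem_coe] at hl hl'
      have := List.append_inj heq (by rw [(h1 l1 hl.1).1, (h1 l3 hl'.1).1])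
      exact Prod.ext this.1 this.2

theorem HasPaths.nil (K : Set S) (x : S) : HasPaths p K x x 0 0 0 0 :=
  ⟨{[]}, by simp, by simp⟩

theorem HasPaths.pow {K : Set S} {x : S} {m : ℕ} {v : L1 (S × S)} {η ρ : ℝ}
    (h : HasPaths p K x x m v η ρ) (q : ℕ) :
    HasPaths p K x x (q * m) ((q : ℝ) • v) (q * η) (q * ρ) := by
  induction q with
  | zero => simpa using HasPaths.nil K x
  | succ q ih =>
    have := ih.comp h
    convert this using 1
    · ring
    · push_cast; rw [add_smul, one_smul]
    · push_cast; ring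
    · push_cast; ring

theorem exists_exp_le_pathWt {x : S} {l : List S} (h : pathWt p x l ≠ 0) :
    ∃ ρ : ℝ, 0 ≤ ρ ∧ ENNReal.ofReal (Real.exp (-ρ)) ≤ pathWt p x l := by
  have htop : pathWt p x l ≠ ⊤ := ne_top_of_le_ne_top ENNReal.one_ne_top (pathWt_le_one x l)
  have hpos : 0 < (pathWt p x l).toReal := ENNReal.toReal_pos h htop
  refine ⟨-Real.log (pathWt p x l).toReal, ?_, ?_⟩
  · rw [neg_nonneg]
    refine Real.log_nonpos hpos.le ?_
    simpa using ENNReal.toReal_mono ENNReal.one_ne_top (pathWt_le_one (p := p) x l)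
  · rw [neg_neg, Real.exp_log hpos, ENNReal.ofReal_toReal htop]

theorem hasPaths_single {x : S} {l : List S} (h : pathWt p x l ≠ 0) :
    ∃ ρ : ℝ, 0 ≤ ρ ∧ HasPaths p {y | y ∈ l} x (pathEnd x l) l.length 0 l.length ρ := by
  obtain ⟨ρ, h0, hρ⟩ := exists_exp_le_pathWt h
  exact ⟨ρ, h0, {l}, by simp [norm_pathCnt], by simpa using hρ⟩

/-- Paths from `x` to `y` with transition counts close to `N • ν`, for all `N`, at an
exponential cost of `r` per unit of `N`. -/
def Flow (p : S → PMF S) (x y : S) (ν : L1 (S × S)) (r : ℝ≥0) : Prop :=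
  ∀ ε : ℝ, 0 < ε → ∃ K : Set S, K.Finite ∧ ∃ c : ℝ, 0 ≤ c ∧ ∀ N : ℕ, ∃ m,
    HasPaths p K x y m ((N : ℝ) • ν) (ε * N + c) (N * (r + ε) + c)

theorem Flow.comp {x y z : S} {ν ν' : L1 (S × S)} {r r' : ℝ≥0} (h : Flow p x y ν r)
    (h' : Flow p y z ν' r') : Flow p x z (ν + ν') (r + r') := by
  intro ε hε
  obtain ⟨K, hK, c, hc, H⟩ := h (ε / 2) (by positivity)
  obtain ⟨K', hK', c', hc', H'⟩ := h' (ε / 2) (by positivity)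
  refine ⟨K ∪ K', hK.union hK', c + c', by positivity, fun N => ?_⟩
  obtain ⟨m, hm⟩ := H N
  obtain ⟨m', hm'⟩ := H' N
  refine ⟨m + m', ((hm.mono_set subset_union_left).comp
    (hm'.mono_set subset_union_right)).mono subset_rfl ?_ ?_⟩
  · rw [smul_add, sub_self, norm_zero]
    apply le_of_eq; ring
  · push_cast
    apply le_of_eq; ring

/-- One fixed connecting path serves for every `N`; its length and cost go into the additive
constant `c`, so connections cost nothing at exponential scale. -/
theorem Reach.flow {x y : S} (h : Reach p x y) : Flow p x y 0 0 := by
  intro ε hε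
  obtain ⟨l, -, he, hw⟩ := h.exists_path
  obtain ⟨ρ, h0, hρ⟩ := hasPaths_single hw
  rw [he] at hρ
  refine ⟨{y | y ∈ l}, List.finite_toSet l, l.length + ρ, by positivity, fun N => ⟨l.length, ?_⟩⟩
  refine hρ.mono subset_rfl ?_ ?_
  · rw [smul_zero, sub_self, norm_zero]
    have : 0 ≤ ε * N := by positivity
    linarith
  · have : (0 : ℝ) ≤ N * (((0 : ℝ≥0) : ℝ) + ε) := by positivity
    have h1 : (0 : ℝ) ≤ l.length := by positivity
    linarith

theorem Flow.smul {x y : S} {ν : L1 (S × S)} {r : ℝ≥0} (h : Flow p x y ν r) (a : ℝ≥0) :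
    Flow p x y ((a : ℝ) • ν) (a * r) := by
  intro ε hε
  have ha : (0 : ℝ) ≤ a := a.2
  -- Using `a + 1` keeps the denominator positive when `a = 0` and still gives `a * ε' ≤ ε`. The
  -- flow is run at the integer time `⌊a * N⌋₊`, and the rounding costs at most `‖ν‖` in the counts.
  set ε' := ε / (a + 1) with hε'
  have hε'0 : 0 < ε' := by positivity
  have haε : a * ε' ≤ ε := by
    rw [hε', mul_div_assoc', div_le_iff₀ (by positivity)]
    nlinarith
  obtain ⟨K, hK, c, hc, H⟩ := h ε' hε'0
  refine ⟨K, hK, c + ‖ν‖, by positivity, fun N => ?_⟩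
  obtain ⟨m, hm⟩ := H ⌊a * (N : ℝ)⌋₊
  have hfl : (⌊a * (N : ℝ)⌋₊ : ℝ) ≤ a * N := Nat.floor_le (by positivity)
  have hfl' := Nat.lt_floor_add_one (a * (N : ℝ))
  have hN : (0 : ℝ) ≤ N := by positivity
  refine ⟨m, hm.mono subset_rfl ?_ ?_⟩
  · rw [smul_smul, ← sub_smul, norm_smul, Real.norm_eq_abs]
    have h1 : |(⌊a * (N : ℝ)⌋₊ : ℝ) - N * a| ≤ 1 := by
      rw [abs_le]; constructor <;> linarith
    have h2 : |(⌊a * (N : ℝ)⌋₊ : ℝ) - N * a| * ‖ν‖ ≤ 1 * ‖ν‖ :=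
      mul_le_mul_of_nonneg_right h1 (norm_nonneg _)
    have h3 : ε' * (⌊a * (N : ℝ)⌋₊ : ℝ) ≤ ε' * (a * N) := by gcongr
    have h4 : a * ε' * N ≤ ε * N := by gcongr
    linarith
  · have h3 : (⌊a * (N : ℝ)⌋₊ : ℝ) * (r + ε') ≤ a * N * (r + ε') := by gcongr
    have h4 : a * ε' * N ≤ ε * N := by gcongr
    have := norm_nonneg ν
    push_cast
    linarith

theorem Flow.mono {x y : S} {ν : L1 (S × S)} {r r' : ℝ≥0} (h : Flow p x y ν r) (hr : r ≤ r') :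
    Flow p x y ν r' := by
  intro ε hε
  obtain ⟨K, hK, c, hc, H⟩ := h ε hε
  refine ⟨K, hK, c, hc, fun N => ?_⟩
  obtain ⟨m, hm⟩ := H N
  have hr' : (r : ℝ) ≤ r' := hr
  exact ⟨m, hm.mono subset_rfl (by simp) (by gcongr)⟩

theorem Flow.of_forall_lt {x y : S} {ν : L1 (S × S)} {r : ℝ≥0}
    (h : ∀ r', r < r' → Flow p x y ν r') : Flow p x y ν r := by
  intro ε hε
  obtain ⟨K, hK, c, hc, H⟩ := h (r + (ε / 2).toNNReal) (by simpa using hε) (ε / 2) (by positivity)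
  refine ⟨K, hK, c, hc, fun N => ?_⟩
  obtain ⟨m, hm⟩ := H N
  refine ⟨m, hm.mono subset_rfl ?_ ?_⟩
  · rw [sub_self, norm_zero, add_zero]
    gcongr
    linarith
  · push_cast
    rw [Real.coe_toNNReal _ (by positivity), add_assoc, add_halves]

/-- A flow of loops can be built out of a single good family of loops for each precision. -/
theorem Flow.of_loops {x : S} {ν : L1 (S × S)} {r : ℝ≥0}
    (h : ∀ ε : ℝ, 0 < ε → ∃ T : ℕ, 0 < T ∧ ∃ K : Set S, K.Finite ∧ ∃ m,
      HasPaths p K x x m ((T : ℝ) • ν) (ε * T) (T * (r + ε))) : Flow p x x ν r := by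
  intro ε hε
  obtain ⟨T, hT, K, hK, m, hm⟩ := h ε hε
  -- The loop family for time `T` is repeated `N / T` times; the remainder, shorter than `T`,
  -- accounts for the constant `T * ‖ν‖`.
  refine ⟨K, hK, T * ‖ν‖, by positivity, fun N => ⟨N / T * m, ?_⟩⟩
  have h1 : ((N / T : ℕ) : ℝ) * T ≤ N := by exact_mod_cast Nat.div_mul_le_self N T
  have h2 : (N : ℝ) ≤ ((N / T : ℕ) : ℝ) * T + T := by
    have := Nat.lt_div_mul_add hT (a := N)
    exact_mod_cast this.le
  refine (hm.pow (N / T)).mono subset_rfl ?_ ?_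
  · rw [smul_smul, ← sub_smul, norm_smul, Real.norm_eq_abs]
    have h3 : |((N / T : ℕ) : ℝ) * T - N| ≤ T := by
      rw [abs_le]; constructor <;> linarith
    have h4 : |((N / T : ℕ) : ℝ) * T - N| * ‖ν‖ ≤ T * ‖ν‖ := by gcongr
    have h5 : ε * (((N / T : ℕ) : ℝ) * T) ≤ ε * N := by gcongr
    linarith
  · have h5 : (((N / T : ℕ) : ℝ) * T) * (r + ε) ≤ N * (r + ε) := by gcongr
    have h6 : 0 ≤ T * ‖ν‖ := by positivity
    linarith

/-- The smallest exponential cost of a flow of loops at `o`. -/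
def loopRate (p : S → PMF S) (o : S) (ν : L1 (S × S)) : ℝ≥0∞ :=
  ⨅ (r : ℝ≥0) (_ : Flow p o o ν r), (r : ℝ≥0∞)

theorem Flow.loopRate_le {o : S} {ν : L1 (S × S)} {r : ℝ≥0} (h : Flow p o o ν r) :
    loopRate p o ν ≤ r := iInf₂_le r h

/-- The infimum is attained, because the definition of a flow already leaves a slack `ε` in the
rate. -/
theorem flow_loopRate {o : S} {ν : L1 (S × S)} (h : loopRate p o ν ≠ ⊤) :
    Flow p o o ν (loopRate p o ν).toNNReal := by
  refine Flow.of_forall_lt fun r' hr' => ?_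
  have : loopRate p o ν < r' := by
    rwa [← ENNReal.coe_toNNReal h, ENNReal.coe_lt_coe]
  simp only [loopRate, iInf_lt_iff] at this
  obtain ⟨r, hr, hlt⟩ := this
  exact hr.mono (by exact_mod_cast hlt.le)

theorem not_flow_of_lt_loopRate {o : S} {ν : L1 (S × S)} {r : ℝ≥0}
    (h : (r : ℝ≥0∞) < loopRate p o ν) : ¬ Flow p o o ν r :=
  fun hf => (hf.loopRate_le.trans_lt h).false

theorem loopRate_zero {o : S} (h : Reach p o o) : loopRate p o 0 = 0 :=
  le_antisymm (by simpa using h.flow.loopRate_le) zero_le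

theorem loopRate_add_le (o : S) (ν ν' : L1 (S × S)) :
    loopRate p o (ν + ν') ≤ loopRate p o ν + loopRate p o ν' := by
  by_cases h : loopRate p o ν = ⊤
  · simp [h]
  by_cases h' : loopRate p o ν' = ⊤
  · simp [h']
  have := ((flow_loopRate h).comp (flow_loopRate h')).loopRate_le
  rwa [ENNReal.coe_add, ENNReal.coe_toNNReal h, ENNReal.coe_toNNReal h'] at this

/-- Recurrence of `o` matters for `a = 0`: the right side is then `0` even if the cost of `ν` is
infinite, so the zero family must be free. -/
theorem loopRate_smul_le {o : S} (ho : Reach p o o) (a : ℝ≥0) (ν : L1 (S × S)) :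
    loopRate p o ((a : ℝ) • ν) ≤ a * loopRate p o ν := by
  rcases eq_or_ne a 0 with rfl | ha
  · simp [loopRate_zero ho]
  by_cases h : loopRate p o ν = ⊤
  · simp [h, ENNReal.mul_top, ha]
  have := ((flow_loopRate h).smul a).loopRate_le
  rwa [ENNReal.coe_mul, ENNReal.coe_toNNReal h] at this

theorem loopRate_smul {o : S} (ho : Reach p o o) (a : ℝ≥0) (ν : L1 (S × S)) :
    loopRate p o ((a : ℝ) • ν) = a * loopRate p o ν := by
  refine le_antisymm (loopRate_smul_le ho a ν) ?_
  rcases eq_or_ne a 0 with rfl | ha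
  · simp
  have h := loopRate_smul_le ho a⁻¹ ((a : ℝ) • ν)
  have ha' : (a : ℝ) ≠ 0 := by exact_mod_cast ha
  rw [smul_smul, NNReal.coe_inv, inv_mul_cancel₀ ha', one_smul] at h
  calc a * loopRate p o ν ≤ a * ((a⁻¹ : ℝ≥0) * loopRate p o ((a : ℝ) • ν)) := by gcongr
    _ = loopRate p o ((a : ℝ) • ν) := by
      rw [← mul_assoc, ← ENNReal.coe_mul, mul_inv_cancel₀ ha, ENNReal.coe_one, one_mul]

end Families

/-! ### Finite measures on a countable space as summable families. -/

section MeasuresAsFamilies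

variable {ι : Type*} [MeasurableSpace ι]

open Classical in
/-- The family of point masses of a measure on a countable space. -/
def toL1 (μ : Measure ι) : L1 ι :=
  if h : Memℓp (fun z => μ.real {z}) 1 then ⟨fun z => μ.real {z}, h⟩ else 0

variable [Countable ι] [MeasurableSingletonClass ι]

theorem tsum_measure_singleton_eq (μ : Measure ι) (A : Set ι) : ∑' z : A, μ {(z : ι)} = μ A := by
  simpa using tsum_measure_preimage_singleton (μ := μ) A.to_countable (f := id)
    fun y _ => measurableSet_singleton y

theorem toL1_apply (μ : Measure ι) [IsFiniteMeasure μ] (z : ι) : toL1 μ z = μ.real {z} := by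
  have h : Memℓp (fun z => μ.real {z}) 1 := by
    have h1 : ∑' z : ι, μ {z} ≠ ⊤ := by
      rw [← tsum_univ, tsum_measure_singleton_eq]
      exact measure_ne_top _ _
    exact L1.memℓp_of_le (ENNReal.summable_toReal h1) fun z => (abs_of_nonneg measureReal_nonneg).le
  rw [toL1, dif_pos h]

theorem toL1_nonneg (μ : Measure ι) [IsFiniteMeasure μ] (z : ι) : 0 ≤ toL1 μ z := by
  rw [toL1_apply]
  exact measureReal_nonneg

theorem toL1_ne_zero_iff (μ : Measure ι) [IsFiniteMeasure μ] (z : ι) :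
    toL1 μ z ≠ 0 ↔ μ {z} ≠ 0 := by
  rw [toL1_apply, measureReal_ne_zero_iff]

theorem norm_toL1 (μ : Measure ι) [IsFiniteMeasure μ] : ‖toL1 μ‖ = μ.real univ := by
  rw [L1.norm_eq, measureReal_def, ← tsum_measure_singleton_eq, tsum_univ (fun z => μ {z}),
    ENNReal.tsum_toReal_eq fun z => measure_ne_top _ _]
  exact tsum_congr fun z => by rw [abs_of_nonneg (toL1_nonneg μ z), toL1_apply]; rfl

theorem toL1_smul_add_smul (a b : ℝ≥0) (μ ν : Measure ι) [IsFiniteMeasure μ] [IsFiniteMeasure ν] :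
    toL1 (a • μ + b • ν) = (a : ℝ) • toL1 μ + (b : ℝ) • toL1 ν := by
  ext z
  rw [lp.coeFn_add, lp.coeFn_smul, lp.coeFn_smul, Pi.add_apply, Pi.smul_apply, Pi.smul_apply,
    toL1_apply, toL1_apply, toL1_apply, measureReal_add_apply]
  rw [measureReal_nnreal_smul_apply, measureReal_nnreal_smul_apply]
  rfl

end MeasuresAsFamilies

/-! ### The law of the chain in terms of path weights. -/

section Law

variable {S Ω : Type*}

/-- The total probability of a set of paths with a given starting point. -/
def pathMass (p : S → PMF S) (x : S) (A : Set (List S)) : ℝ≥0∞ := ∑' l, A.indicator (pathWt p x) l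

theorem pathMass_mono {p : S → PMF S} {x : S} {A B : Set (List S)}
    (h : ∀ l ∈ A, pathWt p x l ≠ 0 → l ∈ B) : pathMass p x A ≤ pathMass p x B := by
  refine ENNReal.tsum_le_tsum fun l => ?_
  by_cases hl : l ∈ A
  · by_cases hw : pathWt p x l = 0
    · simp [indicator, hw]
    · rw [indicator_of_mem hl, indicator_of_mem (h l hl hw)]
  · simp [hl]

theorem sum_le_pathMass {p : S → PMF S} {x : S} {A : Set (List S)} {Γ : Finset (List S)}
    (h : ∀ l ∈ Γ, l ∈ A) : ∑ l ∈ Γ, pathWt p x l ≤ pathMass p x A := by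
  refine le_trans (Finset.sum_le_sum fun l hl => ?_) (ENNReal.sum_le_tsum Γ)
  rw [indicator_of_mem (h l hl)]

/-- The states visited by the process at the times `1, …, n`. -/
def wordOf (X : ℕ → Ω → S) (n : ℕ) (ω : Ω) : List S := (List.range n).map fun i => X (i + 1) ω

theorem length_wordOf (X : ℕ → Ω → S) (n : ℕ) (ω : Ω) : (wordOf X n ω).length = n := by
  simp [wordOf]

theorem wordOf_succ (X : ℕ → Ω → S) (n : ℕ) (ω : Ω) :
    wordOf X (n + 1) ω = wordOf X n ω ++ [X (n + 1) ω] := by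
  simp [wordOf, List.range_succ]

theorem pathEnd_wordOf (X : ℕ → Ω → S) (n : ℕ) (ω : Ω) :
    pathEnd (X 0 ω) (wordOf X n ω) = X n ω := by
  induction n with
  | zero => simp [wordOf]
  | succ n ih => simp [wordOf_succ, pathEnd_append]

open Classical in
theorem pathCnt_wordOf_apply (X : ℕ → Ω → S) (n : ℕ) (ω : Ω) (z : S × S) :
    pathCnt (X 0 ω) (wordOf X n ω) z
      = ∑ k ∈ Finset.range n, if z = (X k ω, X (k + 1) ω) then 1 else 0 := by
  induction n with
  | zero => simp [wordOf]
  | succ n ih =>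
    rw [wordOf_succ, pathCnt_append, pathEnd_wordOf, lp.coeFn_add, Pi.add_apply, ih,
      Finset.sum_range_succ, pathCnt_cons_apply]
    simp

/-- Translates between lists and the infinite sequences in the definition of a Markov chain. The
default `d` is never read, since the indices stay at most `l.length`, the last index of `x :: l`. -/
theorem prod_getD_eq_pathWt (p : S → PMF S) (d x : S) (l : List S) :
    ∏ i ∈ Finset.range l.length, p ((x :: l).getD i d) ((x :: l).getD (i + 1) d)
      = pathWt p x l := by
  induction l generalizing x with
  | nil => simp
  | cons y l ih =>
    rw [List.length_cons, Finset.prod_range_succ', pathWt_cons, ← ih y, mul_comm]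
    simp

theorem isProbabilityMeasure_pairEmp [MeasurableSpace S] {X : ℕ → Ω → S} {n : ℕ} (hn : n ≠ 0)
    (ω : Ω) :
    IsProbabilityMeasure (pairEmp X n ω) := by
  refine ⟨?_⟩
  simp only [pairEmp, Measure.smul_apply, Measure.finsetSum_apply, measure_univ, smul_eq_mul,
    Finset.sum_const, Finset.card_range, nsmul_eq_mul, mul_one]
  exact ENNReal.inv_mul_cancel (by exact_mod_cast hn) (by simp)

theorem toL1_pairEmp [MeasurableSpace S] [Countable S] [MeasurableSingletonClass S]
    {X : ℕ → Ω → S} {n : ℕ} (hn : n ≠ 0) (ω : Ω) :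
    toL1 (pairEmp X n ω) = (n : ℝ)⁻¹ • pathCnt (X 0 ω) (wordOf X n ω) := by
  classical
  have := isProbabilityMeasure_pairEmp (X := X) hn ω
  ext z
  rw [toL1_apply, lp.coeFn_smul, Pi.smul_apply, pathCnt_wordOf_apply, measureReal_def, pairEmp,
    Measure.smul_apply, smul_eq_mul, ENNReal.toReal_mul, Measure.finsetSum_apply,
    ENNReal.toReal_sum fun _ _ => measure_ne_top _ _]
  simp only [ENNReal.toReal_inv, ENNReal.toReal_natCast, smul_eq_mul]
  congr 1
  refine Finset.sum_congr rfl fun k _ => ?_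
  rw [Measure.dirac_apply' _ (measurableSet_singleton z)]
  by_cases h : z = (X k ω, X (k + 1) ω)
  · simp [h]
  · simp [h, Ne.symm h]

theorem tvDist_eq_norm [MeasurableSpace S] [Countable S] [MeasurableSingletonClass S]
    (μ ν : Measure (S × S)) [IsFiniteMeasure μ] [IsFiniteMeasure ν] :
    tvDist μ ν = ‖toL1 μ - toL1 ν‖ / 2 := by
  rw [tvDist, L1.norm_eq]
  congr 1
  exact tsum_congr fun z => by rw [lp.coeFn_sub, Pi.sub_apply, toL1_apply, toL1_apply]

/-- The factor `2` appears because total variation is half of the ℓ¹ distance. -/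
theorem pairEmp_mem_tvBall_iff [MeasurableSpace S] [Countable S]
    [MeasurableSingletonClass S] {X : ℕ → Ω → S} {n : ℕ} (hn : n ≠ 0) (ω : Ω) (μ : Measure (S × S))
    [IsProbabilityMeasure μ] (r : ℝ) : pairEmp X n ω ∈ tvBall μ r ↔
      ‖pathCnt (X 0 ω) (wordOf X n ω) - (n : ℝ) • toL1 μ‖ < 2 * r * n := by
  have h1 := isProbabilityMeasure_pairEmp (X := X) hn ω
  have hn0 : (0 : ℝ) < n := by positivity
  simp only [tvBall, mem_ofPred_eq, h1, true_and]
  rw [tvDist_eq_norm, toL1_pairEmp hn]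
  have : pathCnt (X 0 ω) (wordOf X n ω) - (n : ℝ) • toL1 μ
      = -((n : ℝ) • (toL1 μ - (n : ℝ)⁻¹ • pathCnt (X 0 ω) (wordOf X n ω))) := by
    rw [smul_sub, smul_smul, mul_inv_cancel₀ hn0.ne', one_smul, neg_sub]
  rw [this, norm_neg, norm_smul, Real.norm_natCast, mul_comm (n : ℝ), mul_lt_mul_iff_left₀ hn0,
    div_lt_iff₀ two_pos, mul_comm r]

variable [MeasurableSpace S] [MeasurableSpace Ω] {p : S → PMF S} {β : PMF S} {P : Measure Ω}
  {X : ℕ → Ω → S}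

theorem IsMarkovChain.measure_word_eq (hX : IsMarkovChain p β P X) (x : S) (l : List S) :
    P {ω | (X 0 ω, wordOf X l.length ω) = (x, l)} = β x * pathWt p x l := by
  rw [← prod_getD_eq_pathWt p x x l]
  have := hX.2 l.length fun i => (x :: l).getD i x
  simp only [List.getD_cons_zero] at this
  rw [← this]
  congr 1
  ext ω
  simp only [mem_ofPred_eq, Prod.mk.injEq]
  constructor
  · rintro ⟨h0, hl⟩ i hi
    rcases i with _ | i
    · simpa using h0
    · have hi' : i < l.length := hi
      conv_rhs => rw [← hl]
      simp [wordOf, hi']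
  · intro h
    refine ⟨by simpa using h 0 (Nat.zero_le _), List.ext_getElem (length_wordOf _ _ _) ?_⟩
    intro i h1 h2
    have := h (i + 1) h2
    simpa [wordOf, h2] using this

variable [Countable S] [MeasurableSingletonClass S]

/-- The pair of initial state and word takes countably many values, so the event is split according
to that value. Letting `B` depend on the initial state is needed because the counts do. -/
theorem IsMarkovChain.measure_word_mem (hX : IsMarkovChain p β P X) (n : ℕ)
    (B : S → Set (List S)) :
    P {ω | wordOf X n ω ∈ B (X 0 ω)}
      = ∑' x, β x * pathMass p x {l | l.length = n ∧ l ∈ B x} := by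
  set f : Ω → S × List S := fun ω => (X 0 ω, wordOf X n ω) with hf
  set s : Set (S × List S) := {q | q.2.length = n ∧ q.2 ∈ B q.1} with hs
  have h1 : {ω | wordOf X n ω ∈ B (X 0 ω)} = f ⁻¹' s := by
    ext ω
    simp [hf, hs, length_wordOf]
  have hmeas : ∀ q : S × List S, MeasurableSet (f ⁻¹' {q}) := by
    rintro ⟨x, l⟩
    have : f ⁻¹' {(x, l)} = (X 0 ⁻¹' {x}) ∩ {ω | wordOf X n ω = l} := by
      ext ω; simp [hf]
    rw [this]
    refine (hX.1 0 (measurableSet_singleton x)).inter ?_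
    have : {ω | wordOf X n ω = l}
        = {_ω | l.length = n} ∩ ⋂ i : Fin l.length, X (i + 1) ⁻¹' {l[i]} := by
      ext ω
      simp only [mem_ofPred_eq, mem_inter_iff, mem_iInter, mem_preimage, mem_singleton_iff]
      constructor
      · rintro rfl
        simp [wordOf]
      · rintro ⟨hl, h⟩
        refine List.ext_getElem (by simp [wordOf, hl]) fun i _ h2 => ?_
        simpa [wordOf] using h ⟨i, h2⟩
    rw [this]
    exact (MeasurableSet.const _).inter
      (MeasurableSet.iInter fun i => hX.1 _ (measurableSet_singleton _))
  rw [h1, ← tsum_measure_preimage_singleton s.to_countable fun q _ => hmeas q,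
    tsum_subtype s fun q => P (f ⁻¹' {q}), ENNReal.tsum_prod']
  refine tsum_congr fun x => ?_
  rw [pathMass, ← ENNReal.tsum_mul_left]
  refine tsum_congr fun l => ?_
  by_cases hl : (x, l) ∈ s
  · have hl' : l ∈ {l | l.length = n ∧ l ∈ B x} := hl
    rw [indicator_of_mem hl, indicator_of_mem hl', ← hX.measure_word_eq]
    simp only [hf, hl'.1]
    rfl
  · have hl' : l ∉ {l | l.length = n ∧ l ∈ B x} := hl
    rw [indicator_of_notMem hl, indicator_of_notMem hl', mul_zero]

end Law

/-! ### Adjusting paths to an exactly prescribed length. -/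

section ExactLength

variable {S : Type*} {p : S → PMF S}

/-- The positive total weight provides at least one path, and its length is the ℓ¹ norm of its
counts. -/
theorem HasPaths.abs_length_sub_le {K : Set S} {x y : S} {m : ℕ} {v : L1 (S × S)} {η ρ : ℝ}
    (h : HasPaths p K x y m v η ρ) : |(m : ℝ) - ‖v‖| ≤ η := by
  obtain ⟨Γ, h1, h2⟩ := h
  rcases Γ.eq_empty_or_nonempty with rfl | ⟨l, hl⟩
  · simp at h2
    exact absurd h2 (not_le.2 (Real.exp_pos _))
  · obtain ⟨a, -, -, d⟩ := h1 l hl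
    have := abs_norm_sub_norm_le (pathCnt x l) v
    rw [norm_pathCnt, a] at this
    exact this.trans d

/-- From a recurrent state there are paths of every length, within a finite set and at a
bounded cost per step. -/
theorem Reach.exists_paths {y : S} (h : Reach p y y) : ∃ K : Set S, K.Finite ∧ ∃ κ : ℝ, 0 ≤ κ ∧
    ∀ t : ℕ, ∃ z, HasPaths p K y z t 0 t (κ * (t + 1)) := by
  obtain ⟨l, hl, he, hw⟩ := h.exists_path
  obtain ⟨ρ, h0, hρ⟩ := hasPaths_single hw
  obtain ⟨ρ', h0', hρ'⟩ := exists_exp_le_pathWt hw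
  rw [he] at hρ
  have hL : 0 < l.length := List.length_pos_iff.2 hl
  refine ⟨{y | y ∈ l}, List.finite_toSet l, ρ + ρ', by positivity, fun t => ?_⟩
  -- A loop is repeated `t / l.length` times and followed by its prefix of length `t % l.length`.
  -- The prefix weighs at least as much as the whole loop; where it ends is irrelevant.
  have hq := hρ.pow (t / l.length)
  have hr : HasPaths p {y | y ∈ l} y (pathEnd y (l.take (t % l.length))) (t % l.length) 0
      (t % l.length : ℕ) ρ' := by
    refine ⟨{l.take (t % l.length)}, ?_, ?_⟩
    · have : (l.take (t % l.length)).length = t % l.length := by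
        rw [List.length_take, min_eq_left (Nat.mod_lt _ hL).le]
      simp only [Finset.mem_singleton, forall_eq, this, sub_zero, norm_pathCnt, le_refl, and_true,
        true_and]
      exact fun z hz => List.mem_of_mem_take hz
    · rw [Finset.sum_singleton]
      refine hρ'.trans ?_
      conv_lhs => rw [← List.take_append_drop (t % l.length) l, pathWt_append]
      exact mul_le_of_le_one_right' (pathWt_le_one _ _)
  have hlen : t / l.length * l.length + t % l.length = t := Nat.div_add_mod' t _
  have hlen' : ((t / l.length : ℕ) : ℝ) * l.length + (t % l.length : ℕ) = t := by
    exact_mod_cast hlen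
  have hc := hq.comp hr
  rw [hlen] at hc
  refine ⟨_, hc.mono subset_rfl ?_ ?_⟩
  · simp [hlen']
  · have h1 : ((t / l.length : ℕ) : ℝ) ≤ t := by exact_mod_cast Nat.div_le_self _ _
    have h2 : ((t / l.length : ℕ) : ℝ) * ρ ≤ t * ρ := by gcongr
    have h3 : 0 ≤ ρ' * t := by positivity
    linarith

/-- A flow of unit mass that ends in a recurrent state can be realized with paths of exactly
the prescribed length. -/
theorem Flow.exact {x y : S} {ν : L1 (S × S)} {r : ℝ≥0} (h : Flow p x y ν r) (hy : Reach p y y)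
    (hν : ‖ν‖ = 1) {ε : ℝ} (hε : 0 < ε) : ∃ K : Set S, K.Finite ∧ ∀ᶠ N : ℕ in atTop, ∃ z,
      HasPaths p K x z N ((N : ℝ) • ν) (ε * N) (N * (r + ε)) := by
  obtain ⟨K', hK', κ, hκ, H'⟩ := hy.exists_paths
  -- The flow is run for the shorter time `N' = ⌊(1 - 2e)N⌋`, so that its length cannot exceed `N`,
  -- and the missing steps, at most `3eN + 1 + c`, are filled up at cost `κ` each. The count errors
  -- `eN' + c`, `2eN + 1` and `3eN + 1 + c` sum to at most `7eN`, and the filling brings the `3κ` in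
  -- the cost.
  obtain ⟨e, he0, he1, he2⟩ : ∃ e : ℝ, 0 < e ∧ e ≤ 1 / 4 ∧ e * (7 + 3 * κ) ≤ ε := by
    refine ⟨min (1 / 4) (ε / (7 + 3 * κ)), by positivity, min_le_left _ _, ?_⟩
    rw [← le_div_iff₀ (by positivity)]
    exact min_le_right _ _
  obtain ⟨K, hK, c, hc, H⟩ := h e he0
  refine ⟨K ∪ K', hK.union hK', ?_⟩
  filter_upwards [eventually_ge_atTop ⌈(2 * c + 2 + κ * (2 + c)) / e⌉₊] with N hN
  have hN' : 2 * c + 2 + κ * (2 + c) ≤ e * N := by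
    rw [mul_comm e, ← div_le_iff₀ he0]
    exact Nat.ceil_le.1 hN
  have hκc : 0 ≤ κ * (2 + c) := by positivity
  have hN0 : (0 : ℝ) ≤ N := by positivity
  have hpos : 0 ≤ (1 - 2 * e) * N := mul_nonneg (by linarith) hN0
  set N' := ⌊(1 - 2 * e) * N⌋₊ with hN'def
  have f1 : (N' : ℝ) ≤ (1 - 2 * e) * N := Nat.floor_le hpos
  have f2 : (1 - 2 * e) * N < N' + 1 := Nat.lt_floor_add_one _
  obtain ⟨m, hm⟩ := H N'
  have hlen := abs_le.1 hm.abs_length_sub_le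
  rw [norm_smul, hν, mul_one, Real.norm_natCast] at hlen
  have g1 : e * N' ≤ e * ((1 - 2 * e) * N) := by gcongr
  have g3 : 0 ≤ e * (e * N) := by positivity
  have g4 : (0 : ℝ) ≤ N' := by positivity
  have hmN : (m : ℝ) ≤ N := by linarith [hlen.2]
  have hmN' : m ≤ N := by exact_mod_cast hmN
  obtain ⟨z, hz⟩ := H' (N - m)
  have hcomp := (hm.mono_set (subset_union_left (t := K'))).comp
    (hz.mono_set (subset_union_right (s := K)))
  rw [Nat.add_sub_cancel' hmN', Nat.cast_sub hmN'] at hcomp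
  have ht : (N : ℝ) - m ≤ 3 * e * N + 1 + c := by linarith [hlen.1]
  have he2N : e * (7 + 3 * κ) * N ≤ ε * N := by gcongr
  have hκe : 0 ≤ κ * (e * N) := by positivity
  refine ⟨z, hcomp.mono subset_rfl ?_ ?_⟩
  · rw [add_zero, ← sub_smul, norm_smul, hν, mul_one, Real.norm_eq_abs]
    have : |(N' : ℝ) - N| ≤ 2 * e * N + 1 := by
      rw [abs_le]; constructor <;> linarith [mul_nonneg he0.le hN0]
    linarith [mul_nonneg he0.le hN0]
  · have h1 : κ * ((N : ℝ) - m + 1) ≤ κ * (3 * e * N + 1 + c + 1) := by gcongr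
    have h2 : (N' : ℝ) * (r + e) ≤ N * (r + e) := by
      have : (N' : ℝ) ≤ N := by linarith [mul_nonneg he0.le hN0]
      gcongr
    linarith

end ExactLength

/-! ### From path families to lower exponential rates. -/

section Rates

theorem le_liminf_log_div {f : ℕ → ℝ≥0∞} {s : ℝ}
    (h : ∀ᶠ n : ℕ in atTop, ENNReal.ofReal (Real.exp (-(n * s))) ≤ f n) :
    ((-s : ℝ) : EReal) ≤ liminf (fun n : ℕ => ENNReal.log (f n) / (n : EReal)) atTop := by
  refine le_liminf_of_le (by isBoundedDefault) ?_
  filter_upwards [h, eventually_gt_atTop 0] with n hn hn0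
  have hn0' : (n : ℝ) ≠ 0 := by positivity
  calc ((-s : ℝ) : EReal) = ((-(n * s) : ℝ) : EReal) / (n : EReal) := by
        rw [show (n : EReal) = ((n : ℝ) : EReal) from rfl, ← EReal.coe_div]
        congr 1
        field_simp
    _ ≤ _ := by
      refine EReal.div_le_div_right_of_nonneg (by positivity) ?_
      rw [← Real.log_exp (-(n * s)), ← ENNReal.log_ofReal_of_pos (Real.exp_pos _)]
      exact ENNReal.log_monotone hn

theorem limsup_log_div_le {f : ℕ → ℝ≥0∞} {s : ℝ}
    (h : ∀ᶠ n : ℕ in atTop, f n ≤ ENNReal.ofReal (Real.exp (-(n * s)))) :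
    limsup (fun n : ℕ => ENNReal.log (f n) / (n : EReal)) atTop ≤ ((-s : ℝ) : EReal) := by
  refine limsup_le_of_le (by isBoundedDefault) ?_
  filter_upwards [h, eventually_gt_atTop 0] with n hn hn0
  have hn0' : (n : ℝ) ≠ 0 := by positivity
  calc _ ≤ ((-(n * s) : ℝ) : EReal) / (n : EReal) := by
        refine EReal.div_le_div_right_of_nonneg (by positivity) ?_
        rw [← Real.log_exp (-(n * s)), ← ENNReal.log_ofReal_of_pos (Real.exp_pos _)]
        exact ENNReal.log_monotone hn
    _ = ((-s : ℝ) : EReal) := by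
        rw [show (n : EReal) = ((n : ℝ) : EReal) from rfl, ← EReal.coe_div]
        congr 1
        field_simp

variable {S Ω : Type*} [MeasurableSpace S] [MeasurableSpace Ω] {p : S → PMF S} {β : PMF S}
  {P : Measure Ω} {X : ℕ → Ω → S}

variable [Countable S] [MeasurableSingletonClass S]

/-- The chain starts at `x` with a fixed positive probability, negligible on the exponential scale,
and then follows a path of exact length `N` from the flow. All these paths stay in one finite set,
hence the truncated rate. -/
theorem Flow.le_sLowFin (hX : IsMarkovChain p β P X) {x y : S} {ν : L1 (S × S)} {r : ℝ≥0}
    (h : Flow p x y ν r) (hx : x ∈ β.support) (hy : Reach p y y) (hν : ‖ν‖ = 1)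
    {μ : Measure (S × S)} [IsProbabilityMeasure μ] {δ : ℝ} (hδ : ‖ν - toL1 μ‖ < 2 * δ) :
    ((-(r : ℝ) : ℝ) : EReal) ≤ sLowFin P X (tvBall μ δ) := by
  refine EReal.ge_of_forall_gt_iff_ge.1 fun t ht => ?_
  have ht' : 0 < -t - r := by
    have := EReal.coe_lt_coe_iff.1 ht
    linarith
  -- The first bound gives `r + 2ε ≤ -t`, one `ε` paying for `β x` and one for the flow; the second
  -- keeps the empirical measure inside the ball.
  set ε := min ((-t - r) / 2) ((2 * δ - ‖ν - toL1 μ‖) / 2) with hε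
  have hε0 : 0 < ε := lt_min (by linarith) (by linarith)
  have hε1 : ε ≤ (-t - r) / 2 := min_le_left _ _
  have hε2 : ε ≤ (2 * δ - ‖ν - toL1 μ‖) / 2 := min_le_right _ _
  obtain ⟨K, hK, H⟩ := h.exact hy hν hε0
  have hK' : (insert x K).Finite := hK.insert x
  refine le_trans ?_ (le_iSup _ hK'.toFinset)
  rw [hK'.coe_toFinset, ← neg_neg t]
  refine le_liminf_log_div ?_
  have hβ : 0 < (β x).toReal := ENNReal.toReal_pos hx (β.apply_ne_top x)
  have hβ' : ∀ᶠ N : ℕ in atTop, Real.exp (-(N * ε)) ≤ (β x).toReal := by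
    have : Tendsto (fun N : ℕ => Real.exp (-(N * ε))) atTop (𝓝 0) :=
      Real.tendsto_exp_neg_atTop_nhds_zero.comp
        (tendsto_natCast_atTop_atTop.atTop_mul_const hε0)
    exact this.eventually_le_const hβ
  filter_upwards [H, hβ', eventually_ne_atTop 0] with N hN hNβ hN0
  obtain ⟨z, Γ, h1, h2⟩ := hN
  have hN0' : (0 : ℝ) < N := by positivity
  set B : S → Set (List S) := fun a => {l | a = x ∧ l ∈ Γ} with hB
  have hsub : {ω | wordOf X N ω ∈ B (X 0 ω)}
      ⊆ {ω | pairEmp X N ω ∈ tvBall μ δ ∩ probOn (insert x K)} := by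
    rintro ω ⟨hω0, hω⟩
    obtain ⟨-, -, hk, hd⟩ := h1 _ hω
    have hprob := isProbabilityMeasure_pairEmp (X := X) hN0 ω
    refine ⟨(pairEmp_mem_tvBall_iff hN0 ω μ δ).2 ?_, hprob, fun w hw => ?_⟩
    · rw [hω0]
      have h3 := norm_sub_le_norm_sub_add_norm_sub (pathCnt x (wordOf X N ω)) ((N : ℝ) • ν)
        ((N : ℝ) • toL1 μ)
      rw [← smul_sub, norm_smul, Real.norm_natCast] at h3
      have h4 : (N : ℝ) * (ε + ‖ν - toL1 μ‖) < N * (2 * δ) := by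
        gcongr
        linarith
      linarith
    · have h5 := (toL1_ne_zero_iff (pairEmp X N ω) w).2 hw
      rw [toL1_pairEmp hN0, lp.coeFn_smul, Pi.smul_apply, smul_ne_zero_iff] at h5
      refine pathCnt_ne_zero_mem (x := X 0 ω) (by simp [hω0]) (fun y hy => ?_) h5.2
      exact mem_insert_of_mem _ (hk y hy)
  calc ENNReal.ofReal (Real.exp (-(N * -t)))
      ≤ ENNReal.ofReal (Real.exp (-(N * ε))) * ENNReal.ofReal (Real.exp (-(N * (r + ε)))) := by
        rw [← ENNReal.ofReal_mul (Real.exp_pos _).le, ← Real.exp_add]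
        refine ENNReal.ofReal_le_ofReal (Real.exp_le_exp.2 ?_)
        have : (N : ℝ) * (r + 2 * ε) ≤ N * (-t) := by
          gcongr
          linarith
        linarith
    _ ≤ β x * pathMass p x {l | l.length = N ∧ l ∈ B x} := by
        refine mul_le_mul' ?_ (h2.trans (sum_le_pathMass fun l hl => ⟨(h1 l hl).1, rfl, hl⟩))
        rw [← ENNReal.ofReal_toReal (β.apply_ne_top x)]
        exact ENNReal.ofReal_le_ofReal hNβ
    _ ≤ ∑' a, β a * pathMass p a {l | l.length = N ∧ l ∈ B a} := ENNReal.le_tsum x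
    _ = P {ω | wordOf X N ω ∈ B (X 0 ω)} := (hX.measure_word_mem N B).symm
    _ ≤ _ := measure_mono hsub

end Rates

/-! ### Chaining classes, and the lower bound. -/

section ClassRates

/-- Applied to reachability it yields the last class of a chain (lower bound), and applied to the
reversed relation the first one (upper bound). -/
theorem exists_mem_forall_rel {α : Type*} (R : α → α → Prop)
    (htrans : ∀ a b c, R a b → R b c → R a c) (F : Finset α) (hF : F.Nonempty)
    (htot : ∀ a ∈ F, ∀ b ∈ F, R a b ∨ R b a) : ∃ m ∈ F, ∀ a ∈ F, R a m := by
  classical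
  induction hF using Finset.Nonempty.cons_induction with
  | singleton a => exact ⟨a, by simp, by simpa using htot a (by simp) a (by simp)⟩
  | cons a F ha hF ih =>
    obtain ⟨m, hm, h⟩ := ih fun b hb c hc => htot b (by simp [hb]) c (by simp [hc])
    rcases htot a (by simp) m (by simp [hm]) with h1 | h1
    · refine ⟨m, by simp [hm], fun b hb => ?_⟩
      rcases Finset.mem_cons.1 hb with rfl | hb
      · exact h1
      · exact h b hb
    · refine ⟨a, by simp, fun b hb => ?_⟩
      rcases Finset.mem_cons.1 hb with rfl | hb
      · simpa using htot b (by simp) b (by simp)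
      · exact htrans _ _ _ (h b hb) h1

variable {S : Type*}

/-- The type of irreducible classes. -/
abbrev IrredClass (p : S → PMF S) : Type _ := {C : Set S // IsIrredClass p C}

variable {p : S → PMF S}

/-- The pairs of states of a class. -/
def IrredClass.sq (C : IrredClass p) : Set (S × S) := (C : Set S) ×ˢ (C : Set S)

/-- A base point of a class. -/
def IrredClass.base (C : IrredClass p) : S := C.2.prop.1.some

theorem IrredClass.base_mem (C : IrredClass p) : C.base ∈ (C : Set S) := C.2.prop.1.some_mem

theorem IrredClass.reach_base (C : IrredClass p) : Reach p C.base C.base :=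
  C.2.reach C.base_mem C.base_mem

theorem IrredClass.eq_of_mem {C D : IrredClass p} {x : S} (hC : x ∈ (C : Set S))
    (hD : x ∈ (D : Set S)) : C = D := Subtype.ext (C.2.eq_of_mem D.2 hC hD)

theorem IrredClass.disjoint_sq {C D : IrredClass p} (h : C ≠ D) : Disjoint C.sq D.sq :=
  Set.disjoint_left.2 fun _ hC hD => h (IrredClass.eq_of_mem hC.1 hD.1)

theorem classReach_iff (C D : IrredClass p) :
    ClassReach p (C : Set S) (D : Set S) ↔ Reach p C.base D.base :=
  ⟨fun ⟨_, hx, _, hy, h⟩ => ((C.2.reach C.base_mem hx).trans h).trans (D.2.reach hy D.base_mem),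
    fun h => ⟨_, C.base_mem, _, D.base_mem, h⟩⟩

theorem initReach_iff (β : PMF S) (C : IrredClass p) :
    InitReach p β (C : Set S) ↔ ∃ x ∈ β.support, Reach p x C.base := by
  constructor
  · rintro ⟨y, hy, h | ⟨x, hx, h⟩⟩
    · exact ⟨y, h, C.2.reach hy C.base_mem⟩
    · exact ⟨x, hx, h.trans (C.2.reach hy C.base_mem)⟩
  · rintro ⟨x, hx, h⟩
    exact ⟨_, C.base_mem, Or.inr ⟨x, hx, h⟩⟩

theorem sum_res_sq (F : Finset (IrredClass p)) (f : L1 (S × S)) :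
    ∑ C ∈ F, res C.sq f = res (⋃ C ∈ F, C.sq) f := by
  classical
  induction F using Finset.induction_on with
  | empty => simp [res_eq_zero]
  | insert C F hC ih =>
    rw [Finset.sum_insert hC, ih, Finset.set_biUnion_insert, res_union]
    refine Set.disjoint_iUnion₂_right.2 fun D hD => IrredClass.disjoint_sq ?_
    rintro rfl
    exact hC hD

/-- Loops in totally ordered classes can be chained to a flow. -/
theorem exists_flow_of_classes {β : PMF S} (F : Finset (IrredClass p)) (hF : F.Nonempty)
    (htot : ∀ C ∈ F, ∀ D ∈ F, Reach p C.base D.base ∨ Reach p D.base C.base)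
    (hβ : ∀ C ∈ F, ∃ x ∈ β.support, Reach p x C.base) {ν : IrredClass p → L1 (S × S)}
    {r : IrredClass p → ℝ≥0} (hflow : ∀ C ∈ F, Flow p C.base C.base (ν C) (r C)) :
    ∃ x ∈ β.support, ∃ C ∈ F, Flow p x C.base (∑ D ∈ F, ν D) (∑ D ∈ F, r D) := by
  classical
  induction F using Finset.strongInduction with
  | H F ih =>
    -- `M` is reachable from all the other classes, so its loops can be appended to a flow through
    -- the others, wherever that flow ends.
    obtain ⟨M, hM, hmax⟩ := exists_mem_forall_rel (fun C D : IrredClass p => Reach p C.base D.base)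
      (fun _ _ _ h1 h2 => h1.trans h2) F hF htot
    rw [← Finset.sum_erase_add F ν hM, ← Finset.sum_erase_add F r hM]
    rcases (F.erase M).eq_empty_or_nonempty with h0 | h0
    · obtain ⟨x, hx, h⟩ := hβ M hM
      refine ⟨x, hx, M, hM, ?_⟩
      rw [h0, Finset.sum_empty, Finset.sum_empty]
      exact h.flow.comp (hflow M hM)
    · obtain ⟨x, hx, C, hC, h⟩ := ih (F.erase M) (Finset.erase_ssubset hM) h0
        (fun C hC D hD => htot C (Finset.mem_of_mem_erase hC) D (Finset.mem_of_mem_erase hD))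
        (fun C hC => hβ C (Finset.mem_of_mem_erase hC))
        fun C hC => hflow C (Finset.mem_of_mem_erase hC)
      refine ⟨x, hx, M, hM, ?_⟩
      have h1 := h.comp (hmax C (Finset.mem_of_mem_erase hC)).flow
      rw [add_zero, add_zero] at h1
      exact h1.comp (hflow M hM)

variable [MeasurableSpace S]

/-- The sum over all classes of the costs of the restrictions of `μ` to the classes. -/
def classRateSum (p : S → PMF S) (μ : Measure (S × S)) : ℝ≥0∞ :=
  ∑' C : IrredClass p, loopRate p C.base (res C.sq (toL1 μ))

variable [Countable S] [MeasurableSingletonClass S]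

theorem PreAdmissible.exists_class {μ : Measure (S × S)} (h : PreAdmissible p μ) {z : S × S}
    (hz : μ {z} ≠ 0) : ∃ C : IrredClass p, (C : Set S) ∈ chargedClasses p μ ∧ z ∈ C.sq := by
  have h1 := (isLeast_chargedClasses h).1
  by_contra! hcon
  apply hz
  rw [h1.2, Measure.sum_apply _ (measurableSet_singleton z)]
  refine ENNReal.tsum_eq_zero.2 fun C => ?_
  rw [Measure.restrict_apply (measurableSet_singleton z)]
  have : {z} ∩ ((C : Set S) ×ˢ (C : Set S)) = ∅ := by
    rw [singleton_inter_eq_empty]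
    exact hcon ⟨C, h1.1 C C.2⟩ C.2
  rw [this, measure_empty]

variable {Ω : Type*} [MeasurableSpace Ω] {β : PMF S} {P : Measure Ω} {X : ℕ → Ω → S}

/-- Finitely many charged classes carry mass at least `1 - θ`. Optimal loop flows in them are
chained, and the resulting flow is normalized to mass one, which multiplies the cost by at most `1 /
(1 - θ)`. -/
theorem neg_classRateSum_le_sLowFin (hX : IsMarkovChain p β P X) {μ : Measure (S × S)}
    (hμ : μ ∈ admissible p β) {δ : ℝ} (hδ : 0 < δ) :
    -(classRateSum p μ : EReal) ≤ sLowFin P X (tvBall μ δ) := by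
  classical
  obtain ⟨hprob, hpre, htot, hβ⟩ := hμ
  by_cases htop : classRateSum p μ = ⊤
  · simp [htop]
  have hne : ∀ C : IrredClass p, loopRate p C.base (res C.sq (toL1 μ)) ≠ ⊤ :=
    fun C => ENNReal.ne_top_of_tsum_ne_top htop C
  set R : ℝ≥0 := (classRateSum p μ).toNNReal with hR
  have hRe : (classRateSum p μ : EReal) = ((R : ℝ) : EReal) := by
    rw [← ENNReal.coe_toNNReal htop]
    rfl
  rw [hRe, ← EReal.coe_neg]
  refine EReal.ge_of_forall_gt_iff_ge.1 fun t ht => ?_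
  have ht' : 0 < -t - R := by
    have := EReal.coe_lt_coe_iff.1 ht
    linarith
  -- Truncation and normalization each move the family by at most `θ`, so `θ < δ` suffices for the
  -- ball of ℓ¹ radius `2 * δ`. The last condition is `R < (1 - θ) * -t`, which absorbs the
  -- normalized cost.
  obtain ⟨θ, hθ0, hθδ, hθt⟩ : ∃ θ : ℝ, 0 < θ ∧ θ < δ ∧ θ * -t < -t - R := by
    have h1 : 0 < -t := by linarith [R.2]
    refine ⟨min (δ / 2) ((-t - R) / (2 * -t)), by positivity,
      (min_le_left _ _).trans_lt (by linarith), ?_⟩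
    calc _ ≤ (-t - R) / (2 * -t) * -t := by gcongr; exact min_le_right _ _
      _ = (-t - R) / 2 := by rw [← div_div, div_mul_cancel₀ _ h1.ne']
      _ < _ := by linarith
  obtain ⟨Fz, hFz⟩ := exists_finset_norm_sub_res_le (toL1 μ) hθ0
  choose c hc using fun z : {z // μ {z} ≠ 0} => hpre.exists_class z.2
  set F : Finset (IrredClass p) :=
    (Fz.subtype fun z => μ {z} ≠ 0).image c with hF
  have hcharged : ∀ C ∈ F, (C : Set S) ∈ chargedClasses p μ := by
    intro C hC
    obtain ⟨z, -, rfl⟩ := Finset.mem_image.1 hC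
    exact (hc z).1
  have hclose := hFz (⋃ C ∈ F, C.sq) fun z hz hz0 => by
    rw [toL1_ne_zero_iff] at hz0
    refine mem_iUnion₂.2 ⟨c ⟨z, hz0⟩, Finset.mem_image_of_mem _ (by simpa using hz), ?_⟩
    exact (hc ⟨z, hz0⟩).2
  rw [← sum_res_sq] at hclose
  set ν := ∑ C ∈ F, res C.sq (toL1 μ) with hν
  have hμ1 : ‖toL1 μ‖ = 1 := by simp [norm_toL1]
  have hν1 : ‖ν‖ ≤ 1 := by
    rw [hν, sum_res_sq, ← hμ1]
    exact norm_res_le _ _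
  have hν2 : 1 - θ ≤ ‖ν‖ := by
    have := norm_sub_norm_le (toL1 μ) ν
    linarith
  have hθ1 : θ < 1 := by
    by_contra! hcon
    have : 0 ≤ (θ - 1) * -t := mul_nonneg (by linarith) (by linarith [R.2])
    linarith [R.2]
  have hν0 : 0 < ‖ν‖ := by linarith
  have hFne : F.Nonempty := by
    rw [Finset.nonempty_iff_ne_empty]
    intro h0
    rw [hν, h0] at hν0
    simp at hν0
  obtain ⟨x, hx, C, -, hflow⟩ := exists_flow_of_classes (β := β) F hFne
    (fun C hC D hD => by
      simpa only [classReach_iff] using htot C (hcharged C hC) D (hcharged D hD))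
    (fun C hC => (initReach_iff β C).1 (hβ C (hcharged C hC)))
    (fun C _ => flow_loopRate (hne C))
  rw [← hν] at hflow
  have hflow' := hflow.smul ‖ν‖₊⁻¹
  have hnorm : ‖((‖ν‖₊⁻¹ : ℝ≥0) : ℝ) • ν‖ = 1 := by
    rw [norm_smul]
    simp [hν0.ne']
  have hdist : ‖((‖ν‖₊⁻¹ : ℝ≥0) : ℝ) • ν - toL1 μ‖ < 2 * δ := by
    have h1 : ‖((‖ν‖₊⁻¹ : ℝ≥0) : ℝ) • ν - ν‖ = 1 - ‖ν‖ := by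
      have : ((‖ν‖₊⁻¹ : ℝ≥0) : ℝ) • ν - ν = (‖ν‖⁻¹ - 1) • ν := by
        rw [sub_smul, one_smul]; rfl
      rw [this, norm_smul, Real.norm_of_nonneg]
      · rw [sub_mul, inv_mul_cancel₀ hν0.ne', one_mul]
      · rw [sub_nonneg]
        exact (one_le_inv₀ hν0).2 hν1
    have h2 := norm_sub_le_norm_sub_add_norm_sub (((‖ν‖₊⁻¹ : ℝ≥0) : ℝ) • ν) ν (toL1 μ)
    rw [norm_sub_rev] at hclose
    linarith
  refine le_trans ?_ (hflow'.le_sLowFin hX hx C.reach_base hnorm hdist)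
  rw [EReal.coe_le_coe_iff]
  set r := ∑ D ∈ F, (loopRate p D.base (res D.sq (toL1 μ))).toNNReal with hr
  have hrR : (r : ℝ) ≤ R := by
    have : (r : ℝ≥0∞) ≤ (R : ℝ≥0∞) := by
      rw [hR, ENNReal.coe_toNNReal htop, hr, ENNReal.ofNNReal_finsetSum]
      simp only [ENNReal.coe_toNNReal (hne _)]
      exact ENNReal.sum_le_tsum F
    exact_mod_cast this
  push_cast
  rw [le_neg, inv_mul_le_iff₀ hν0]
  have : (1 - θ) * -t ≤ ‖ν‖ * -t := mul_le_mul_of_nonneg_right hν2 (by linarith [R.2])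
  linarith

end ClassRates

/-! ### Total weight of sets of paths. -/

section PathMass

variable {S : Type*} {p : S → PMF S}

theorem pathMass_biUnion_le {ι : Type*} (x : S) (s : Finset ι) (A : ι → Set (List S)) :
    pathMass p x (⋃ i ∈ s, A i) ≤ ∑ i ∈ s, pathMass p x (A i) := by
  simp only [pathMass]
  rw [← Summable.tsum_finsetSum fun _ _ => ENNReal.summable]
  refine ENNReal.tsum_le_tsum fun l => ?_
  by_cases hl : l ∈ ⋃ i ∈ s, A i
  · obtain ⟨i, hi, hli⟩ := mem_iUnion₂.1 hl
    rw [indicator_of_mem hl]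
    calc _ = (A i).indicator (pathWt p x) l := (indicator_of_mem hli _).symm
      _ ≤ _ := Finset.single_le_sum (f := fun i => (A i).indicator (pathWt p x) l)
        (fun _ _ => zero_le) hi
  · simp [indicator_of_notMem hl]

theorem pathMass_length_eq (x : S) (n : ℕ) : pathMass p x {l | l.length = n} = 1 := by
  induction n generalizing x with
  | zero =>
    rw [pathMass, tsum_eq_single []]
    · simp
    · intro l hl
      simp [hl]
  | succ n ih =>
    have hinj : Function.Injective fun q : S × List S => q.1 :: q.2 := by
      rintro ⟨a, l⟩ ⟨b, l'⟩ h
      simpa using h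
    rw [pathMass, ← hinj.tsum_eq, ENNReal.tsum_prod']
    · rw [← (p x).tsum_coe]
      refine tsum_congr fun y => ?_
      rw [← mul_one (p x y), ← ih y, pathMass, ← ENNReal.tsum_mul_left]
      refine tsum_congr fun l => ?_
      by_cases hl : l.length = n <;> simp [indicator, hl]
    · intro l hl
      rcases l with _ | ⟨a, l⟩
      · simp at hl
      · exact ⟨(a, l), rfl⟩

/-- Path weights sum to one for each length from `0` to `n`. This is the source of the polynomial
factor in the upper bound. -/
theorem pathMass_length_le (x : S) (n : ℕ) : pathMass p x {l | l.length ≤ n} ≤ n + 1 := by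
  have h : {l : List S | l.length ≤ n} = ⋃ m ∈ Finset.range (n + 1), {l | l.length = m} := by
    ext l
    simp
  rw [h]
  refine (pathMass_biUnion_le _ _ _).trans ?_
  simp [pathMass_length_eq]

/-- Markov property combined with a union bound: a path may split in several ways, and all
admissible splittings are summed. -/
theorem pathMass_append_le (x : S) (A : Set (List S)) (B : S → Set (List S)) :
    pathMass p x {l | ∃ l₁ l₂, l = l₁ ++ l₂ ∧ l₁ ∈ A ∧ l₂ ∈ B (pathEnd x l₁)}
      ≤ pathMass p x A * ⨆ y, pathMass p y (B y) := by
  classical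
  set s : Set (List S × List S) := {q | q.1 ∈ A ∧ q.2 ∈ B (pathEnd x q.1)} with hs
  calc _ ≤ ∑' l, ∑' q : List S × List S, if q ∈ s ∧ l = q.1 ++ q.2 then pathWt p x l else 0 := by
        refine ENNReal.tsum_le_tsum fun l => ?_
        by_cases hl : l ∈ {l | ∃ l₁ l₂, l = l₁ ++ l₂ ∧ l₁ ∈ A ∧ l₂ ∈ B (pathEnd x l₁)}
        · obtain ⟨l₁, l₂, h, h1, h2⟩ := id hl
          refine le_trans ?_ (ENNReal.le_tsum (l₁, l₂))
          rw [if_pos ⟨⟨h1, h2⟩, h⟩, indicator_of_mem hl]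
        · simp [indicator_of_notMem hl]
    _ = ∑' q : List S × List S, if q ∈ s then pathWt p x (q.1 ++ q.2) else 0 := by
        rw [ENNReal.tsum_comm]
        refine tsum_congr fun q => ?_
        rw [tsum_eq_single (q.1 ++ q.2)]
        · simp
        · intro l hl
          rw [if_neg fun h => hl h.2]
    _ = ∑' l₁, A.indicator (pathWt p x) l₁ * pathMass p (pathEnd x l₁) (B (pathEnd x l₁)) := by
        rw [ENNReal.tsum_prod']
        refine tsum_congr fun l₁ => ?_
        rw [pathMass, ← ENNReal.tsum_mul_left]
        refine tsum_congr fun l₂ => ?_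
        by_cases h1 : l₁ ∈ A <;> by_cases h2 : l₂ ∈ B (pathEnd x l₁) <;>
          simp [hs, h1, h2, pathWt_append]
    _ ≤ ∑' l₁, A.indicator (pathWt p x) l₁ * ⨆ y, pathMass p y (B y) := by
        refine ENNReal.tsum_le_tsum fun l₁ => mul_le_mul_right ?_ _
        exact le_iSup (fun y => pathMass p y (B y)) _
    _ = _ := by rw [ENNReal.tsum_mul_right, pathMass]

end PathMass

/-! ### Cutting a path into its passages through the classes. -/

section Decomposition

variable {S : Type*} {p : S → PMF S}

theorem snd_mem_of_pathCnt_ne_zero {x : S} {l : List S} {z : S × S} (hz : pathCnt x l z ≠ 0) :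
    z.2 ∈ l := by
  induction l generalizing x with
  | nil => simp at hz
  | cons y l ih =>
    rw [pathCnt_cons_apply] at hz
    split_ifs at hz with h
    · simp [h]
    · exact List.mem_cons_of_mem _ (ih (x := y) (by simpa using hz))

theorem reach_pathEnd_of_mem {x y : S} {l : List S} (hw : pathWt p x l ≠ 0) (hy : y ∈ l) :
    y = pathEnd x l ∨ Reach p y (pathEnd x l) := by
  induction l generalizing x with
  | nil => simp at hy
  | cons a l ih =>
    rw [pathWt_cons, mul_ne_zero_iff] at hw
    rw [pathEnd_cons]
    rcases List.mem_cons.1 hy with rfl | hy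
    · rcases eq_or_ne l [] with rfl | h
      · simp
      · exact Or.inr (reach_pathEnd h hw.2)
    · exact ih hw.2 hy

/-- Up to the first visit every transition starts outside `K`, including the one that enters it.
After the last visit every transition ends outside `K`, which gives the companion lemma. -/
theorem exists_first_visit {K : Set S} {x : S} {l : List S} (h : x ∈ K ∨ ∃ y ∈ l, y ∈ K) :
    ∃ l₁ l₂, l = l₁ ++ l₂ ∧ pathEnd x l₁ ∈ K ∧ ∀ z ∈ K ×ˢ K, pathCnt x l₁ z = 0 := by
  induction l generalizing x with
  | nil => exact ⟨[], [], by simpa using h⟩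
  | cons y l ih =>
    by_cases hx : x ∈ K
    · exact ⟨[], y :: l, by simpa using hx⟩
    · obtain ⟨l₁, l₂, h1, h2, h3⟩ := ih (x := y) (by simpa [hx] using h)
      refine ⟨y :: l₁, l₂, by simp [h1], by simpa using h2, fun z hz => ?_⟩
      rw [pathCnt_cons_apply, h3 z hz, if_neg, add_zero]
      rintro rfl
      exact hx hz.1

theorem exists_last_visit {K : Set S} {x : S} (hx : x ∈ K) (l : List S) :
    ∃ l₁ l₂, l = l₁ ++ l₂ ∧ pathEnd x l₁ ∈ K ∧
      ∀ z ∈ K ×ˢ K, pathCnt (pathEnd x l₁) l₂ z = 0 := by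
  induction l using List.reverseRecOn with
  | nil => exact ⟨[], [], by simpa using hx⟩
  | append_singleton l y ih =>
    by_cases hy : y ∈ K
    · exact ⟨l ++ [y], [], by simp, by simpa [pathEnd_append] using hy, by simp⟩
    · obtain ⟨l₁, l₂, rfl, h2, h3⟩ := ih
      refine ⟨l₁, l₂ ++ [y], by simp, h2, fun z hz => ?_⟩
      rw [pathCnt_append, lp.coeFn_add, Pi.add_apply, h3 z hz, pathCnt_cons_apply, if_neg]
      · simp
      · rintro rfl
        exact hy hz.2

/-- Paths of length at most `n` that start and end in `K` and whose transition counts are close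
to `n • ν`. -/
def closePaths (ν : L1 (S × S)) (K : Set S) (n : ℕ) (ε : ℝ) (a : S) : Set (List S) :=
  {l | a ∈ K ∧ pathEnd a l ∈ K ∧ l.length ≤ n ∧ ‖pathCnt a l - (n : ℝ) • ν‖ ≤ n * ε}

/-- A path whose transition counts in a class are close to `n • f` contains a path that starts
and ends in a large finite part of the class and has almost the same counts there. -/
theorem exists_closePaths (C : IrredClass p) {K : Set S} (hK : K ⊆ C) {f : L1 (S × S)} {θ : ℝ}
    (hf : ‖res C.sq f - res (K ×ˢ K) f‖ ≤ θ) (hθ : 3 * θ < ‖res C.sq f‖) {n : ℕ} (hn : n ≠ 0)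
    {x : S} {l : List S} (hw : pathWt p x l ≠ 0) (hl : l.length ≤ n)
    (h : ‖res C.sq (pathCnt x l) - (n : ℝ) • res C.sq f‖ ≤ n * θ) :
    ∃ l₁ l₂ l₃, l = l₁ ++ (l₂ ++ l₃) ∧
      l₂ ∈ closePaths (res C.sq f) K n (3 * θ) (pathEnd x l₁) := by
  have hsq : K ×ˢ K ⊆ C.sq := prod_mono hK hK
  have hn0 : (0 : ℝ) < n := by positivity
  set D := C.sq \ K ×ˢ K with hD
  have hsplit : ∀ g : L1 (S × S), res C.sq g = res (K ×ˢ K) g + res D g := by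
    intro g
    rw [← res_union disjoint_sdiff_right, union_sdiff_cancel hsq]
  have hDf : ‖res D f‖ ≤ θ := by
    rwa [hsplit, add_sub_cancel_left] at hf
  -- One `n * θ` is the deviation of the counts, the other the mass that `n • f` has on `D`.
  have hDcnt : ‖res D (pathCnt x l)‖ ≤ 2 * n * θ := by
    have h1 : res D (pathCnt x l)
        = res D (res C.sq (pathCnt x l) - (n : ℝ) • res C.sq f) + (n : ℝ) • res D f := by
      rw [map_sub, map_smul, res_res, res_res, inter_eq_left.2 (sdiff_subset (s := C.sq))]
      abel
    rw [h1]
    refine (norm_add_le _ _).trans ?_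
    rw [norm_smul, Real.norm_natCast]
    have h2 := (norm_res_le D _).trans h
    have h3 : (n : ℝ) * ‖res D f‖ ≤ n * θ := by gcongr
    linarith
  -- A path avoiding `K` would have all its counts in the class on `D`, so at least `n * ‖res C.sq
  -- f‖ - n * θ`, more than `2 * n * θ`.
  have hvisit : ∃ y ∈ l, y ∈ K := by
    by_contra! hcon
    have h0 : res (K ×ˢ K) (pathCnt x l) = 0 := res_eq_zero fun z hz => by
      by_contra hz0
      exact hcon z.2 (snd_mem_of_pathCnt_ne_zero hz0) hz.2
    rw [hsplit (pathCnt x l), h0, zero_add] at h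
    have h1 := norm_sub_norm_le ((n : ℝ) • res C.sq f) (res D (pathCnt x l))
    rw [norm_sub_rev, norm_smul, Real.norm_natCast] at h1
    have h2 : (n : ℝ) * (3 * θ) < n * ‖res C.sq f‖ := by gcongr
    linarith
  obtain ⟨l₁, l', rfl, he1, hz1⟩ := exists_first_visit (x := x) (Or.inr hvisit)
  obtain ⟨l₂, l₃, rfl, he2, hz2⟩ := exists_last_visit he1 l'
  refine ⟨l₁, l₂, l₃, rfl, he1, he2, ?_, ?_⟩
  · simp only [List.length_append] at hl
    lia
  set y := pathEnd x l₁
  rw [pathWt_append, pathWt_append, mul_ne_zero_iff, mul_ne_zero_iff] at hw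
  -- The middle piece starts and ends in the class and so never leaves it. The outer pieces have no
  -- transition in `K ×ˢ K`, so within the class they only contribute on `D`: at most `2 * n * θ`,
  -- for a total error of `3 * n * θ`.
  have hin : res C.sq (pathCnt y l₂) = pathCnt y l₂ :=
    res_eq_self fun z hz => pathCnt_ne_zero_mem (hK he1)
      (C.2.path_mem (hK he1) (hK he2) hw.2.1) hz
  set g := pathCnt x l₁ + pathCnt (pathEnd y l₂) l₃ with hg
  have hcnt : pathCnt x (l₁ ++ (l₂ ++ l₃)) = pathCnt y l₂ + g := by
    rw [pathCnt_append, pathCnt_append, hg]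
    abel
  have hg0 : res (K ×ˢ K) g = 0 := by
    rw [hg, map_add, res_eq_zero hz1, res_eq_zero hz2, add_zero]
  have hgD : ‖res D g‖ ≤ 2 * n * θ := by
    refine le_trans (L1.norm_mono fun z => ?_) hDcnt
    have g1 : 0 ≤ g z := add_nonneg (pathCnt_nonneg _ _ z) (pathCnt_nonneg _ _ z)
    have g2 := pathCnt_nonneg y l₂ z
    rw [hcnt, res_apply, res_apply]
    by_cases hz : z ∈ D
    · rw [indicator_of_mem hz, indicator_of_mem hz, lp.coeFn_add (pathCnt y l₂) g,
        Pi.add_apply, abs_of_nonneg g1, abs_of_nonneg (add_nonneg g2 g1)]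
      linarith
    · simp [hz]
  have hfin : pathCnt y l₂ - (n : ℝ) • res C.sq f
      = (res C.sq (pathCnt x (l₁ ++ (l₂ ++ l₃))) - (n : ℝ) • res C.sq f) - res D g := by
    rw [hcnt, map_add, hin, hsplit g, hg0]
    abel
  rw [hfin]
  refine (norm_sub_le _ _).trans ?_
  linarith

theorem IrredClass.eq_of_reach {C D : IrredClass p} {x y : S} (hx : x ∈ (C : Set S))
    (hy : y ∈ (D : Set S)) (h1 : Reach p x y) (h2 : Reach p y x) : C = D :=
  IrredClass.eq_of_mem (C.2.mem_of_reach hx hx h1 h2) hy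

/-- A path with prescribed transition counts in several classes passes through these classes one
after the other. -/
theorem pathMass_le_prod (F : Finset (IrredClass p))
    (htot : ∀ C ∈ F, ∀ D ∈ F, Reach p C.base D.base ∨ Reach p D.base C.base)
    {K : IrredClass p → Set S} (hK : ∀ C ∈ F, K C ⊆ C) {f : L1 (S × S)} {θ : ℝ}
    (hf : ∀ C ∈ F, ‖res C.sq f - res (K C ×ˢ K C) f‖ ≤ θ) (hθ : ∀ C ∈ F, 3 * θ < ‖res C.sq f‖)
    {n : ℕ} (hn : n ≠ 0) (x : S) :
    pathMass p x {l | l.length ≤ n ∧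
        ∀ C ∈ F, ‖res C.sq (pathCnt x l) - (n : ℝ) • res C.sq f‖ ≤ n * θ}
      ≤ (n + 1) ^ (F.card + 1) *
        ∏ C ∈ F, ⨆ a, pathMass p a (closePaths (res C.sq f) (K C) n (3 * θ) a) := by
  classical
  induction F using Finset.strongInduction generalizing x with
  | H F ih =>
  rcases F.eq_empty_or_nonempty with rfl | hF
  · simpa using pathMass_length_le x n
  -- The relation is reversed: `M` reaches all the other classes, so it is traversed first.
  obtain ⟨M, hM, hmin⟩ := exists_mem_forall_rel (fun C D : IrredClass p => Reach p D.base C.base)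
    (fun _ _ _ h1 h2 => h2.trans h1) F hF fun C hC D hD => (htot C hC D hD).symm
  set G : S → Set (List S) := fun x => {l | l.length ≤ n ∧
    ∀ C ∈ F.erase M, ‖res C.sq (pathCnt x l) - (n : ℝ) • res C.sq f‖ ≤ n * θ} with hG
  set A := closePaths (res M.sq f) (K M) n (3 * θ) with hA
  set B : S → Set (List S) := fun y =>
    {l | ∃ l₂ l₃, l = l₂ ++ l₃ ∧ l₂ ∈ A y ∧ l₃ ∈ G (pathEnd y l₂)} with hB
  have hsub : ∀ l ∈ {l | l.length ≤ n ∧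
      ∀ C ∈ F, ‖res C.sq (pathCnt x l) - (n : ℝ) • res C.sq f‖ ≤ n * θ}, pathWt p x l ≠ 0 →
      l ∈ {l | ∃ l₁ l', l = l₁ ++ l' ∧ l₁ ∈ {l : List S | l.length ≤ n} ∧
        l' ∈ B (pathEnd x l₁)} := by
    rintro l ⟨hl, hC⟩ hw
    obtain ⟨l₁, l₂, l₃, rfl, h2⟩ :=
      exists_closePaths M (hK M hM) (hf M hM) (hθ M hM) hn hw hl (hC M hM)
    simp only [List.length_append] at hl
    refine ⟨l₁, l₂ ++ l₃, rfl, by simp only [mem_ofPred_eq]; lia, l₂, l₃, rfl, h2,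
      by lia, fun C hCF => ?_⟩
    have hend : pathEnd x (l₁ ++ l₂) ∈ (M : Set S) := by
      rw [pathEnd_append]
      exact hK M hM h2.2.1
    -- A visit to `C` before the end of the passage through `M` would make `C` reach `M`; since `M`
    -- reaches `C`, the two would coincide. So all the counts of `C` come from `l₃`, and the
    -- induction applies there.
    have hzero : res C.sq (pathCnt x (l₁ ++ l₂)) = 0 := by
      refine res_eq_zero fun z hz => ?_
      by_contra hz0
      have hmem := snd_mem_of_pathCnt_ne_zero hz0
      rw [← List.append_assoc, pathWt_append, mul_ne_zero_iff] at hw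
      apply Finset.ne_of_mem_erase hCF
      rcases reach_pathEnd_of_mem hw.1 hmem with h3 | h3
      · exact IrredClass.eq_of_mem hz.2 (h3 ▸ hend)
      · refine IrredClass.eq_of_reach hz.2 hend h3 ?_
        exact ((M.2.reach hend M.base_mem).trans (hmin C (Finset.mem_of_mem_erase hCF))).trans
          (C.2.reach C.base_mem hz.2)
    have := hC C (Finset.mem_of_mem_erase hCF)
    rw [← List.append_assoc, pathCnt_append, map_add, hzero, zero_add, pathEnd_append] at this
    exact this
  -- Each class costs one factor `n + 1` for the unconstrained piece before it, and the empty set of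
  -- classes one more for the final piece.
  have hcard : F.card + 1 = ((F.erase M).card + 1) + 1 := by
    rw [Finset.card_erase_add_one hM]
  have hIH : ∀ y, pathMass p y (G y) ≤ (n + 1) ^ ((F.erase M).card + 1) *
      ∏ C ∈ F.erase M, ⨆ a, pathMass p a (closePaths (res C.sq f) (K C) n (3 * θ) a) :=
    ih (F.erase M) (Finset.erase_ssubset hM)
      (fun C hC D hD => htot C (Finset.mem_of_mem_erase hC) D (Finset.mem_of_mem_erase hD))
      (fun C hC => hK C (Finset.mem_of_mem_erase hC))
      (fun C hC => hf C (Finset.mem_of_mem_erase hC))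
      fun C hC => hθ C (Finset.mem_of_mem_erase hC)
  rw [← Finset.mul_prod_erase F _ hM, hcard, pow_succ]
  refine (pathMass_mono hsub).trans ((pathMass_append_le _ _ _).trans ?_)
  calc _ ≤ ((n : ℝ≥0∞) + 1) * ((⨆ a, pathMass p a (A a)) * ((n + 1) ^ ((F.erase M).card + 1) *
      ∏ C ∈ F.erase M, ⨆ a, pathMass p a (closePaths (res C.sq f) (K C) n (3 * θ) a))) := by
        refine mul_le_mul' (pathMass_length_le x n) (iSup_le fun y => ?_)
        refine (pathMass_append_le _ _ _).trans (mul_le_mul' ?_ (iSup_le hIH))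
        exact le_iSup (fun a => pathMass p a (A a)) y
    _ = _ := by ring

end Decomposition

/-! ### The exponential upper bound. -/

section UpperBound

variable {S : Type*} {p : S → PMF S}

theorem eventually_mul_pow_le_exp (c : ℝ) (k : ℕ) {η : ℝ} (hη : 0 < η) :
    ∀ᶠ n : ℕ in atTop, c * ((n : ℝ) + 1) ^ k ≤ Real.exp (n * η) := by
  have h1 : Tendsto (fun n : ℕ => η * ((n : ℝ) + 1)) atTop atTop :=
    (tendsto_atTop_add_const_right _ _ tendsto_natCast_atTop_atTop).const_mul_atTop hη
  have h2 : Tendsto (fun n : ℕ => c * ((η * ((n : ℝ) + 1)) ^ k * Real.exp (-(η * ((n : ℝ) + 1)))))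
      atTop (𝓝 (c * 0)) :=
    ((Real.tendsto_pow_mul_exp_neg_atTop_nhds_zero k).comp h1).const_mul c
  rw [mul_zero] at h2
  have h3 : 0 < η ^ k * Real.exp (-η) := by positivity
  filter_upwards [h2.eventually_le_const h3] with n hn
  have h4 : Real.exp (-(η * ((n : ℝ) + 1))) = Real.exp (-η) * (Real.exp (n * η))⁻¹ := by
    rw [← Real.exp_neg, ← Real.exp_add]
    congr 1
    ring
  rw [mul_pow, h4] at hn
  have h5 : c * ((n : ℝ) + 1) ^ k * (Real.exp (n * η))⁻¹ * (η ^ k * Real.exp (-η))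
      ≤ 1 * (η ^ k * Real.exp (-η)) := by
    rw [one_mul]
    linarith
  have h6 := le_of_mul_le_mul_right h5 h3
  rwa [← div_eq_mul_inv, div_le_one (Real.exp_pos _)] at h6

/-- Connections between a base point and a finite subset of its class, at a uniformly bounded
cost. -/
theorem IrredClass.exists_connections (C : IrredClass p) {K : Set S} (hK : K ⊆ C)
    (hfin : K.Finite) : ∃ L : Set S, L.Finite ∧ ∃ c : ℝ, 0 ≤ c ∧ ∀ a ∈ K,
      (∃ m, HasPaths p L C.base a m 0 c c) ∧ ∃ m, HasPaths p L a C.base m 0 c c := by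
  induction K, hfin using Set.Finite.induction_on with
  | empty => exact ⟨∅, finite_empty, 0, le_rfl, by simp⟩
  | @insert a K _ _ ih =>
    obtain ⟨L, hL, c, hc, H⟩ := ih ((subset_insert a K).trans hK)
    have ha : a ∈ (C : Set S) := hK (mem_insert a K)
    have key : ∀ x ∈ (C : Set S), ∀ y ∈ (C : Set S), ∃ L : Set S, L.Finite ∧ ∃ c : ℝ, 0 ≤ c ∧
        ∃ m, HasPaths p L x y m 0 c c := by
      intro x hx y hy
      obtain ⟨l, -, he, hw⟩ := (C.2.reach hx hy).exists_path
      obtain ⟨ρ, h0, hρ⟩ := hasPaths_single hw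
      rw [he] at hρ
      exact ⟨_, List.finite_toSet l, l.length + ρ, by positivity, l.length,
        hρ.mono subset_rfl (by simpa using h0) (by simp)⟩
    obtain ⟨L₁, hL₁, c₁, hc₁, m₁, h₁⟩ := key _ C.base_mem _ ha
    obtain ⟨L₂, hL₂, c₂, hc₂, m₂, h₂⟩ := key _ ha _ C.base_mem
    refine ⟨L ∪ (L₁ ∪ L₂), hL.union (hL₁.union hL₂), c + (c₁ + c₂), by positivity, ?_⟩
    intro b hb
    rcases mem_insert_iff.1 hb with rfl | hb
    · refine ⟨⟨m₁, h₁.mono (by grind) ?_ ?_⟩, m₂, h₂.mono (by grind) ?_ ?_⟩ <;>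
        (try simp only [sub_self, norm_zero]) <;> linarith
    · obtain ⟨⟨m, h⟩, m', h'⟩ := H b hb
      refine ⟨⟨m, h.mono (by grind) ?_ ?_⟩, m', h'.mono (by grind) ?_ ?_⟩ <;>
        (try simp only [sub_self, norm_zero]) <;> linarith

/-- If loops cannot realize `ν` at cost `r`, then the paths between points of a finite subset of
the class whose transition counts are close to `n • ν` have an exponentially small probability. -/
theorem eventually_closePaths_le (C : IrredClass p) {ν : L1 (S × S)} {r : ℝ≥0}
    (h : ¬ Flow p C.base C.base ν r) : ∃ ε : ℝ, 0 < ε ∧ ∀ K : Set S, K ⊆ C → K.Finite →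
      ∀ᶠ n : ℕ in atTop, ⨆ a, pathMass p a (closePaths ν K n ε a)
        ≤ ENNReal.ofReal (Real.exp (-(n * r))) := by
  classical
  -- If loops cannot realize `ν` at cost `r`, they fail at some precision `e` for every time `T >
  -- 0`. Half of `e` is kept for closing up paths into loops.
  have h' := mt Flow.of_loops h
  push Not at h'
  obtain ⟨e, he, H⟩ := h'
  refine ⟨e / 2, by positivity, fun K hK hfin => ?_⟩
  obtain ⟨L, hL, c, hc, hconn⟩ := C.exists_connections hK hfin
  set k := hfin.toFinset.card with hk
  filter_upwards [eventually_mul_pow_le_exp k 1 (half_pos he), eventually_gt_atTop 0,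
    eventually_ge_atTop ⌈4 * c / e⌉₊] with n hn hn0 hnc
  have hnc' : 4 * c ≤ n * e := by
    rw [← div_le_iff₀ he]
    exact Nat.ceil_le.1 hnc
  rw [pow_one] at hn
  refine iSup_le fun a => ?_
  by_contra! hcon
  have ha : a ∈ K := by
    by_contra ha
    have : closePaths ν K n (e / 2) a = ∅ := by
      ext l
      simp [closePaths, ha]
    simp [this, pathMass] at hcon
  have hk0 : 0 < k := Finset.card_pos.2 ⟨a, by simpa using ha⟩
  -- Pigeonhole over end point and length: there are only `k * (n + 1)` cells, so one of them
  -- carries mass above `exp (-(n * (r + e / 2)))`.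
  set A : S × ℕ → Set (List S) := fun q =>
    {l | l ∈ closePaths ν K n (e / 2) a ∧ pathEnd a l = q.1 ∧ l.length = q.2} with hA
  set s := hfin.toFinset ×ˢ Finset.range (n + 1) with hs
  have hcover : closePaths ν K n (e / 2) a ⊆ ⋃ q ∈ s, A q := by
    intro l hl
    refine mem_iUnion₂.2 ⟨(pathEnd a l, l.length), ?_, hl, rfl, rfl⟩
    rw [hs, Finset.mem_product]
    exact ⟨by simpa using hl.2.1, by simpa [Nat.lt_succ_iff] using hl.2.2.1⟩
  set t : ℝ := Real.exp (-(n * (r + e / 2))) with ht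
  obtain ⟨⟨b, m⟩, hq, hlt⟩ : ∃ q ∈ s, ENNReal.ofReal t < pathMass p a (A q) := by
    by_contra! hle
    refine absurd hcon (not_lt.2 ?_)
    calc _ ≤ ∑ q ∈ s, pathMass p a (A q) :=
          (pathMass_mono fun l hl _ => hcover hl).trans (pathMass_biUnion_le _ _ _)
      _ ≤ s.card • ENNReal.ofReal t := Finset.sum_le_card_nsmul _ _ _ hle
      _ = ENNReal.ofReal (k * (n + 1) * t) := by
          rw [nsmul_eq_mul, hs, Finset.card_product, Finset.card_range,
            ENNReal.ofReal_mul (by positivity)]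
          congr 1
          rw [← ENNReal.ofReal_natCast]
          push_cast
          rfl
      _ ≤ ENNReal.ofReal (Real.exp (n * (e / 2)) * t) := by gcongr
      _ = _ := by
          rw [ht, ← Real.exp_add]
          congr 2
          ring
  rw [pathMass, ENNReal.tsum_eq_iSup_sum, lt_iSup_iff] at hlt
  obtain ⟨Γ, hΓ⟩ := hlt
  have hb : b ∈ K := by
    rw [hs, Finset.mem_product] at hq
    simpa using hq.1
  obtain ⟨⟨m₁, h₁⟩, -⟩ := hconn a ha
  obtain ⟨-, m₂, h₂⟩ := hconn b hb
  set Γ' := Γ.filter (· ∈ A (b, m)) with hΓ'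
  set L' : Set S := ⋃ l ∈ Γ', {z | z ∈ l} with hL'
  have hL'fin : L'.Finite := Γ'.finite_toSet.biUnion fun l _ => List.finite_toSet l
  have hmid : HasPaths p L' a b m ((n : ℝ) • ν) (n * (e / 2)) (n * (r + e / 2)) := by
    refine ⟨Γ', fun l hl => ?_, ?_⟩
    · have hlA := (Finset.mem_filter.1 hl).2
      exact ⟨hlA.2.2, hlA.2.1, fun z hz => mem_iUnion₂.2 ⟨l, hl, hz⟩, hlA.1.2.2.2⟩
    · refine hΓ.le.trans (le_of_eq ?_)
      rw [hΓ', Finset.sum_filter]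
      exact Finset.sum_congr rfl fun l _ => indicator_apply _ _ _
  -- The loop goes from the base point to `a`, along the heavy cell to `b`, and back. The
  -- connections add `2 * c ≤ n * e / 2` to both error and cost, contradicting the choice of `e` at
  -- `T = n`.
  have hall := ((h₁.mono_set (subset_union_left (t := L'))).comp
    (hmid.mono_set (subset_union_right (s := L)))).comp (h₂.mono_set (subset_union_left (t := L')))
  refine H n hn0 (L ∪ L') (hL.union hL'fin) _ (hall.mono subset_rfl ?_ ?_)
  · rw [zero_add, add_zero, sub_self, norm_zero]
    linarith
  · linarith

variable [MeasurableSpace S] [Countable S] [MeasurableSingletonClass S]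
variable {Ω : Type*} [MeasurableSpace Ω] {β : PMF S} {P : Measure Ω} {X : ℕ → Ω → S}

theorem IsMarkovChain.measure_tvBall_le (hX : IsMarkovChain p β P X) (μ : Measure (S × S))
    [IsProbabilityMeasure μ] (δ : ℝ) {n : ℕ} (hn : n ≠ 0) :
    P {ω | pairEmp X n ω ∈ tvBall μ δ} ≤ ⨆ x ∈ β.support, pathMass p x
      {l | l.length = n ∧ ‖pathCnt x l - (n : ℝ) • toL1 μ‖ < 2 * δ * n} := by
  have h := hX.measure_word_mem n fun x => {l | ‖pathCnt x l - (n : ℝ) • toL1 μ‖ < 2 * δ * n}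
  simp only [pairEmp_mem_tvBall_iff hn]
  refine h.trans_le ?_
  set M := ⨆ x ∈ β.support, pathMass p x
      {l | l.length = n ∧ ‖pathCnt x l - (n : ℝ) • toL1 μ‖ < 2 * δ * n} with hM
  calc _ ≤ ∑' x, β x * M := by
        refine ENNReal.tsum_le_tsum fun x => ?_
        by_cases hx : β x = 0
        · simp [hx]
        · gcongr
          exact le_iSup₂ (f := fun x (_ : x ∈ β.support) => pathMass p x
            {l | l.length = n ∧ ‖pathCnt x l - (n : ℝ) • toL1 μ‖ < 2 * δ * n}) x hx
    _ = M := by rw [ENNReal.tsum_mul_right, β.tsum_coe, one_mul]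

/-- Stated for rates `r C` that no flow achieves, rather than for the costs themselves, because the
costs may be infinite. -/
theorem rlUpp_le_neg_sum (hX : IsMarkovChain p β P X) (μ : Measure (S × S))
    [IsProbabilityMeasure μ] (F : Finset (IrredClass p))
    (htot : ∀ C ∈ F, ∀ D ∈ F, Reach p C.base D.base ∨ Reach p D.base C.base)
    {r : IrredClass p → ℝ≥0} (hr : ∀ C ∈ F, ¬ Flow p C.base C.base (res C.sq (toL1 μ)) (r C)) :
    rlUpp P X μ ≤ ((-(∑ C ∈ F, r C : ℝ≥0) : ℝ) : EReal) := by
  classical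
  set f := toL1 μ with hf
  -- A class without mass has a free flow, so it cannot satisfy `hr`.
  have hpos : ∀ C ∈ F, 0 < ‖res C.sq f‖ := by
    intro C hC
    rw [norm_pos_iff]
    intro h0
    have := hr C hC
    rw [h0] at this
    exact this (C.reach_base.flow.mono zero_le)
  have hε : ∀ C : IrredClass p, ∃ ε : ℝ, 0 < ε ∧ (C ∈ F → ∀ K : Set S, K ⊆ C → K.Finite →
      ∀ᶠ n : ℕ in atTop, ⨆ a, pathMass p a (closePaths (res C.sq f) K n ε a)
        ≤ ENNReal.ofReal (Real.exp (-(n * r C)))) := by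
    intro C
    by_cases hC : C ∈ F
    · obtain ⟨ε, h1, h2⟩ := eventually_closePaths_le C (hr C hC)
      exact ⟨ε, h1, fun _ => h2⟩
    · exact ⟨1, one_pos, fun h => absurd h hC⟩
  choose ε hε0 hε using hε
  obtain ⟨θ, hθ0, hθ⟩ : ∃ θ : ℝ, 0 < θ ∧ ∀ C ∈ F, 3 * θ ≤ ε C ∧ 3 * θ < ‖res C.sq f‖ := by
    have h1 : ∀ᶠ θ : ℝ in 𝓝[>] 0, ∀ C ∈ F, 3 * θ ≤ ε C ∧ 3 * θ < ‖res C.sq f‖ := by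
      rw [Filter.eventually_all_finset]
      intro C hC
      have ht : Tendsto (fun θ : ℝ => 3 * θ) (𝓝[>] 0) (𝓝 0) := by
        have : Continuous fun θ : ℝ => 3 * θ := by fun_prop
        simpa using (this.tendsto 0).mono_left nhdsWithin_le_nhds
      exact (ht.eventually_le_const (hε0 C)).and (ht.eventually_lt_const (hpos C hC))
    obtain ⟨θ, h2, h3⟩ := (h1.and self_mem_nhdsWithin).exists
    exact ⟨θ, h3, h2⟩
  have hK : ∀ C : IrredClass p, ∃ K : Set S, K ⊆ C ∧ K.Finite ∧
      ‖res C.sq f - res (K ×ˢ K) f‖ ≤ θ := by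
    intro C
    obtain ⟨Fz, hFz⟩ := exists_finset_norm_sub_res_le (res C.sq f) hθ0
    set K : Set S := (C : Set S) ∩ ((Fz.image Prod.fst ∪ Fz.image Prod.snd : Finset S) : Set S)
      with hKdef
    refine ⟨K, inter_subset_left, (Finset.finite_toSet _).inter_of_right _, ?_⟩
    have hsq : K ×ˢ K ⊆ C.sq := prod_mono inter_subset_left inter_subset_left
    have := hFz (K ×ˢ K) fun z hz hz0 => by
      have hzC : z ∈ C.sq := by
        by_contra hzC
        exact hz0 (by rw [res_apply, indicator_of_notMem hzC])
      refine ⟨⟨hzC.1, ?_⟩, hzC.2, ?_⟩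
      · exact Finset.mem_union_left _ (Finset.mem_image_of_mem _ hz)
      · exact Finset.mem_union_right _ (Finset.mem_image_of_mem _ hz)
    rwa [res_res, inter_eq_left.2 hsq] at this
  choose K hKC hKfin hKf using hK
  refine EReal.le_of_forall_lt_iff_le.1 fun t ht => ?_
  set R : ℝ≥0 := ∑ C ∈ F, r C with hR
  have ht' : 0 < t + R := by
    have := EReal.coe_lt_coe_iff.1 ht
    linarith
  -- Total variation radius `θ / 2` is ℓ¹ radius `θ`, the precision required in each class.
  refine (iInf_le _ (⟨θ / 2, half_pos hθ0⟩ : Ioi (0 : ℝ))).trans ?_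
  rw [← neg_neg t]
  refine limsup_log_div_le ?_
  have hev : ∀ᶠ n : ℕ in atTop, ∀ C ∈ F, ⨆ a, pathMass p a (closePaths (res C.sq f) (K C) n (ε C) a)
      ≤ ENNReal.ofReal (Real.exp (-(n * r C))) := by
    rw [Filter.eventually_all_finset]
    exact fun C hC => hε C hC (K C) (hKC C) (hKfin C)
  filter_upwards [hev, eventually_ne_atTop 0, eventually_mul_pow_le_exp 1 (F.card + 1) ht']
    with n hn hn0 hnexp
  refine (hX.measure_tvBall_le μ _ hn0).trans (iSup₂_le fun x _ => ?_)
  have hsub : ∀ l ∈ {l | l.length = n ∧ ‖pathCnt x l - (n : ℝ) • f‖ < 2 * (θ / 2) * n},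
      pathWt p x l ≠ 0 → l ∈ {l | l.length ≤ n ∧
        ∀ C ∈ F, ‖res C.sq (pathCnt x l) - (n : ℝ) • res C.sq f‖ ≤ n * θ} := by
    rintro l ⟨hl, hd⟩ -
    refine ⟨hl.le, fun C _ => ?_⟩
    rw [← map_smul, ← map_sub]
    refine (norm_res_le _ _).trans (hd.le.trans ?_)
    apply le_of_eq; ring
  refine (pathMass_mono hsub).trans ((pathMass_le_prod F htot (fun C _ => hKC C)
    (fun C _ => hKf C) (fun C hC => (hθ C hC).2) hn0 x).trans ?_)
  calc _ ≤ ENNReal.ofReal (((n : ℝ) + 1) ^ (F.card + 1)) *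
        ∏ C ∈ F, ENNReal.ofReal (Real.exp (-(n * r C))) := by
        refine mul_le_mul' (le_of_eq ?_) (Finset.prod_le_prod' fun C hC => ?_)
        · rw [ENNReal.ofReal_pow (by positivity), ENNReal.ofReal_add (by positivity) one_pos.le]
          simp
        · refine le_trans (iSup_mono fun a => pathMass_mono fun l hl _ => ?_) (hn C hC)
          refine ⟨hl.1, hl.2.1, hl.2.2.1, hl.2.2.2.trans ?_⟩
          have := (hθ C hC).1
          gcongr
    _ = ENNReal.ofReal (((n : ℝ) + 1) ^ (F.card + 1) * Real.exp (-(n * R))) := by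
        rw [← ENNReal.ofReal_prod_of_nonneg fun _ _ => (Real.exp_pos _).le,
          ← Real.exp_sum, ← ENNReal.ofReal_mul (by positivity), Finset.sum_neg_distrib,
          ← Finset.mul_sum, hR]
        push_cast
        rfl
    _ ≤ ENNReal.ofReal (Real.exp (n * (t + R)) * Real.exp (-(n * R))) := by
        rw [one_mul] at hnexp
        gcongr
    _ = _ := by
        rw [← Real.exp_add]
        congr 2
        ring

/-- The sum is a supremum over finite sets of classes. Classes of zero cost are dropped; the
remaining ones are charged, hence totally ordered, and their possibly infinite costs are
approximated strictly from below. -/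
theorem rlUpp_le_neg_classRateSum (hX : IsMarkovChain p β P X) {μ : Measure (S × S)}
    (hμ : μ ∈ admissible p β) : rlUpp P X μ ≤ -(classRateSum p μ : EReal) := by
  classical
  obtain ⟨hprob, hpre, htot, hβ⟩ := hμ
  have hcharged : ∀ C : IrredClass p, loopRate p C.base (res C.sq (toL1 μ)) ≠ 0 →
      (C : Set S) ∈ chargedClasses p μ := by
    intro C hC
    refine ⟨C.2, fun h0 => hC ?_⟩
    rw [res_eq_zero, loopRate_zero C.reach_base]
    intro z hz
    rw [toL1_apply, measureReal_eq_zero_iff]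
    exact measure_mono_null (singleton_subset_iff.2 hz) h0
  rw [EReal.le_neg]
  have hnn : 0 ≤ -rlUpp P X μ := by
    have h0 := rlUpp_le_neg_sum hX μ ∅ (by simp) (r := fun _ => 0) (by simp)
    rw [EReal.le_neg]
    simpa using h0
  have hcoe : (((-rlUpp P X μ).toENNReal : ℝ≥0∞) : EReal) = -rlUpp P X μ :=
    EReal.coe_toENNReal hnn
  rw [← hcoe, EReal.coe_ennreal_le_coe_ennreal_iff, classRateSum, ENNReal.tsum_eq_iSup_sum]
  refine iSup_le fun F => ?_
  rw [← Finset.sum_filter_ne_zero]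
  set F' := F.filter fun C : IrredClass p => loopRate p C.base (res C.sq (toL1 μ)) ≠ 0 with hF'
  have hpos : ∀ C : IrredClass p, ∃ u : ℕ → ℝ≥0∞,
      (C ∈ F' → ∀ n, u n < loopRate p C.base (res C.sq (toL1 μ))) ∧
      Tendsto u atTop (𝓝 (loopRate p C.base (res C.sq (toL1 μ)))) := by
    intro C
    by_cases hC : C ∈ F'
    · obtain ⟨u, -, hu, hlim⟩ :=
        exists_seq_strictMono_tendsto' (pos_iff_ne_zero.2 (Finset.mem_filter.1 hC).2)
      exact ⟨u, fun _ n => (hu n).2, hlim⟩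
    · exact ⟨fun _ => _, fun h => absurd h hC, tendsto_const_nhds⟩
  choose u hu hlim using hpos
  refine le_of_tendsto' (tendsto_finsetSum F' fun C _ => hlim C) fun n => ?_
  have hne : ∀ C ∈ F', u C n ≠ ⊤ := fun C hC => (hu C hC n).ne_top
  have key := rlUpp_le_neg_sum hX μ F'
    (fun C hC D hD => by
      simpa only [classReach_iff] using htot C (hcharged C (Finset.mem_filter.1 hC).2) D
        (hcharged D (Finset.mem_filter.1 hD).2))
    (r := fun C => (u C n).toNNReal) (fun C hC => not_flow_of_lt_loopRate (by
      rw [ENNReal.coe_toNNReal (hne C hC)]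
      exact hu C hC n))
  have hsum : ∑ C ∈ F', u C n = ((∑ C ∈ F', (u C n).toNNReal : ℝ≥0) : ℝ≥0∞) := by
    rw [ENNReal.ofNNReal_finsetSum]
    exact Finset.sum_congr rfl fun C hC => (ENNReal.coe_toNNReal (hne C hC)).symm
  rw [hsum, ← EReal.coe_ennreal_le_coe_ennreal_iff, hcoe, EReal.le_neg]
  exact key

end UpperBound

/-! ### Only balanced admissible measures can be approached. -/

section Admissibility

variable {S : Type*} {p : S → PMF S}

theorem reach_of_mem {x y : S} {l : List S} (hw : pathWt p x l ≠ 0) (hy : y ∈ l) :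
    Reach p x y := by
  induction l generalizing x with
  | nil => simp at hy
  | cons a l ih =>
    rw [pathWt_cons, mul_ne_zero_iff] at hw
    rcases List.mem_cons.1 hy with rfl | hy
    · exact Relation.TransGen.single hw.1
    · exact Relation.TransGen.head hw.1 (ih hw.2 hy)

theorem eq_or_reach_of_mem {x a b : S} {l : List S} (hw : pathWt p x l ≠ 0) (ha : a ∈ x :: l)
    (hb : b ∈ x :: l) : a = b ∨ Reach p a b ∨ Reach p b a := by
  induction l generalizing x with
  | nil => simp_all
  | cons y l ih =>
    rcases List.mem_cons.1 ha with rfl | ha'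
    · rcases List.mem_cons.1 hb with rfl | hb'
      · exact Or.inl rfl
      · exact Or.inr (Or.inl (reach_of_mem hw hb'))
    · rcases List.mem_cons.1 hb with rfl | hb'
      · exact Or.inr (Or.inr (reach_of_mem hw ha'))
      · rw [pathWt_cons, mul_ne_zero_iff] at hw
        exact ih hw.2 ha' hb'

theorem fst_mem_of_pathCnt_ne_zero {x : S} {l : List S} {z : S × S} (hz : pathCnt x l z ≠ 0) :
    z.1 ∈ x :: l := by
  induction l generalizing x with
  | nil => simp at hz
  | cons y l ih =>
    rw [pathCnt_cons_apply] at hz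
    split_ifs at hz with h
    · simp [h]
    · exact List.mem_cons_of_mem _ (ih (x := y) (by simpa using hz))

/-- A transition that occurs more than once belongs to a cycle. -/
theorem reach_of_one_lt_pathCnt {x : S} {l : List S} {z : S × S} (hw : pathWt p x l ≠ 0)
    (hz : 1 < pathCnt x l z) : Reach p z.1 z.2 ∧ Reach p z.2 z.1 := by
  induction l generalizing x with
  | nil => simp at hz; linarith
  | cons y l ih =>
    rw [pathWt_cons, mul_ne_zero_iff] at hw
    rw [pathCnt_cons_apply] at hz
    split_ifs at hz with h
    · subst h
      have h1 : pathCnt y l (x, y) ≠ 0 := by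
        intro h0
        rw [h0] at hz
        linarith
      have hxy : Reach p x y := Relation.TransGen.single hw.1
      refine ⟨hxy, ?_⟩
      rcases List.mem_cons.1 (fst_mem_of_pathCnt_ne_zero h1) with h2 | h2
      · have h2' : x = y := h2
        subst h2'
        exact hxy
      · exact reach_of_mem hw.2 h2
    · exact ih hw.2 (by simpa using hz)

open Classical in
/-- A path leaves a set as often as it enters it, up to the end points. -/
theorem norm_res_pathCnt_balance (A : Set S) (x : S) (l : List S) :
    ‖res (A ×ˢ univ) (pathCnt x l)‖ + (if pathEnd x l ∈ A then 1 else 0)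
      = ‖res (univ ×ˢ A) (pathCnt x l)‖ + (if x ∈ A then 1 else 0) := by
  induction l generalizing x with
  | nil =>
    rw [pathCnt_nil, map_zero, map_zero]
    rfl
  | cons y l ih =>
    have hsingle : ∀ z, 0 ≤ (lp.single 1 (x, y) 1 : L1 (S × S)) z := by
      intro z
      simp only [lp.single_apply, Pi.single_apply]
      split_ifs <;> norm_num
    have hnorm : ∀ B : Set (S × S), ‖res B (lp.single 1 (x, y) 1 : L1 (S × S))‖
        = if (x, y) ∈ B then 1 else 0 := by
      intro B
      split_ifs with hB
      · rw [res_eq_self, lp.norm_single (by simp), norm_one]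
        intro z hz
        rw [lp.single_apply, Pi.single_apply] at hz
        split_ifs at hz with h
        · rwa [h]
        · exact absurd rfl hz
      · rw [res_eq_zero, norm_zero]
        intro z hz
        rw [lp.single_apply, Pi.single_apply, if_neg]
        rintro rfl
        exact hB hz
    have hstep : ∀ B : Set (S × S), ‖res B (pathCnt x (y :: l))‖
        = (if (x, y) ∈ B then 1 else 0) + ‖res B (pathCnt y l)‖ := by
      intro B
      rw [pathCnt_cons, map_add, L1.norm_add_of_nonneg (res_nonneg hsingle)
        (res_nonneg (pathCnt_nonneg y l)), hnorm]
    have := ih y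
    rw [hstep, hstep, pathEnd_cons]
    simp only [mem_prod, mem_univ, and_true, true_and]
    linarith

variable [MeasurableSpace S] [Countable S] [MeasurableSingletonClass S]

theorem preAdmissible_of_reach {μ : Measure (S × S)}
    (h : ∀ z, μ {z} ≠ 0 → Reach p z.1 z.2 ∧ Reach p z.2 z.1) : PreAdmissible p μ := by
  refine ⟨{C | IsIrredClass p C}, fun C hC => hC, Measure.ext_of_singleton fun z => ?_⟩
  have hz := measurableSet_singleton z
  rw [Measure.sum_apply _ hz]
  by_cases h0 : μ {z} = 0
  · rw [h0, eq_comm, ENNReal.tsum_eq_zero]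
    intro C
    rw [Measure.restrict_apply hz]
    exact measure_mono_null inter_subset_left h0
  · obtain ⟨C, hC, h1, h2⟩ := exists_class (h z h0).1 (h z h0).2
    rw [tsum_eq_single ⟨C, hC⟩]
    · rw [Measure.restrict_apply hz, inter_eq_left.2]
      exact singleton_subset_iff.2 ⟨h1, h2⟩
    · rintro ⟨D, hD⟩ hne
      rw [Measure.restrict_apply hz, singleton_inter_eq_empty.2, measure_empty]
      rintro ⟨h3, -⟩
      exact hne (Subtype.ext (hD.eq_of_mem hC h3 h1))

theorem norm_res_toL1 (μ : Measure (S × S)) [IsFiniteMeasure μ] (A : Set (S × S)) :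
    ‖res A (toL1 μ)‖ = μ.real A := by
  have h : res A (toL1 μ) = toL1 (μ.restrict A) := by
    ext z
    rw [res_apply, toL1_apply, measureReal_restrict_apply (measurableSet_singleton z)]
    by_cases hz : z ∈ A
    · rw [indicator_of_mem hz, toL1_apply, inter_eq_left.2 (singleton_subset_iff.2 hz)]
    · rw [indicator_of_notMem hz, singleton_inter_eq_empty.2 hz, measureReal_empty]
  rw [h, norm_toL1, measureReal_restrict_apply_univ]

/-- A measure that is a limit of pair empirical measures of possible paths is admissible and
balanced. -/
theorem mem_admissibleBal_of_approx {β : PMF S} {μ : Measure (S × S)} [IsProbabilityMeasure μ]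
    (h : ∀ δ : ℝ, 0 < δ → ∃ᶠ n : ℕ in atTop, ∃ x ∈ β.support, ∃ l : List S,
      pathWt p x l ≠ 0 ∧ ‖pathCnt x l - (n : ℝ) • toL1 μ‖ < δ * n) : μ ∈ admissibleBal p β := by
  -- Both masses are at least `2 * δ`, so a path with counts within `δ * n` of `n • μ` uses both
  -- transitions more than `n * δ ≥ 1` times. A single path for the pair `z`, `w` is what makes
  -- their classes comparable.
  have hpt : ∀ z w : S × S, μ {z} ≠ 0 → μ {w} ≠ 0 → ∃ x ∈ β.support, ∃ l : List S,
      pathWt p x l ≠ 0 ∧ 1 < pathCnt x l z ∧ 1 < pathCnt x l w := by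
    intro z w hz hw
    have hpos : ∀ z, μ {z} ≠ 0 → 0 < toL1 μ z := fun z hz =>
      lt_of_le_of_ne (toL1_nonneg μ z) ((toL1_ne_zero_iff μ z).2 hz).symm
    set δ := min (toL1 μ z) (toL1 μ w) / 2 with hδ
    have hδ0 : 0 < δ := half_pos (lt_min (hpos z hz) (hpos w hw))
    obtain ⟨n, ⟨x, hx, l, hl, hd⟩, hn⟩ :=
      ((h δ hδ0).and_eventually (eventually_ge_atTop ⌈1 / δ⌉₊)).exists
    have hn' : 1 ≤ n * δ := by
      rw [← div_le_iff₀ hδ0]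
      exact Nat.ceil_le.1 hn
    have key : ∀ z, 2 * δ ≤ toL1 μ z → 1 < pathCnt x l z := by
      intro z hz
      have h1 := (lp.norm_apply_le_norm (by simp) (pathCnt x l - (n : ℝ) • toL1 μ) z).trans_lt hd
      rw [lp.coeFn_sub, Pi.sub_apply, lp.coeFn_smul, Pi.smul_apply, smul_eq_mul, Real.norm_eq_abs,
        abs_lt] at h1
      have h2 : (n : ℝ) * (2 * δ) ≤ n * toL1 μ z := by gcongr
      linarith [h1.1]
    refine ⟨x, hx, l, hl, key z ?_, key w ?_⟩
    · linarith [min_le_left (toL1 μ z) (toL1 μ w)]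
    · linarith [min_le_right (toL1 μ z) (toL1 μ w)]
  have hcharged : ∀ C ∈ chargedClasses p μ, ∃ z ∈ C ×ˢ C, μ {z} ≠ 0 := by
    intro C hC
    by_contra! hcon
    refine hC.2 ?_
    rw [← tsum_measure_singleton_eq]
    exact ENNReal.tsum_eq_zero.2 fun z => hcon z z.2
  refine ⟨⟨inferInstance, preAdmissible_of_reach fun z hz => ?_, fun C hC D hD => ?_,
    fun C hC => ?_⟩, fun A => ?_⟩
  · obtain ⟨x, -, l, hl, h1, -⟩ := hpt z z hz hz
    exact reach_of_one_lt_pathCnt hl h1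
  · obtain ⟨z, hzC, hz⟩ := hcharged C hC
    obtain ⟨w, hwD, hw⟩ := hcharged D hD
    obtain ⟨x, -, l, hl, h1, h2⟩ := hpt z w hz hw
    rcases eq_or_reach_of_mem hl (fst_mem_of_pathCnt_ne_zero (zero_lt_one.trans h1).ne')
      (fst_mem_of_pathCnt_ne_zero (zero_lt_one.trans h2).ne') with h3 | h3 | h3
    · exact Or.inl ⟨z.1, hzC.1, w.1, hwD.1, hC.1.reach hzC.1 (hC.1.eq_of_mem hD.1 hzC.1
        (h3 ▸ hwD.1) ▸ hwD.1)⟩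
    · exact Or.inl ⟨_, hzC.1, _, hwD.1, h3⟩
    · exact Or.inr ⟨_, hwD.1, _, hzC.1, h3⟩
  · obtain ⟨z, hzC, hz⟩ := hcharged C hC
    obtain ⟨x, hx, l, hl, h1, -⟩ := hpt z z hz hz
    refine ⟨z.1, hzC.1, ?_⟩
    rcases List.mem_cons.1 (fst_mem_of_pathCnt_ne_zero (zero_lt_one.trans h1).ne') with h2 | h2
    · exact Or.inl (h2 ▸ hx)
    · exact Or.inr ⟨x, hx, reach_of_mem hl h2⟩
  · rw [← measureReal_eq_measureReal_iff, ← norm_res_toL1, ← norm_res_toL1]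
    set a := ‖res (A ×ˢ univ) (toL1 μ)‖
    set b := ‖res (univ ×ˢ A) (toL1 μ)‖
    refine eq_of_forall_dist_le fun ε hε => ?_
    rw [Real.dist_eq]
    obtain ⟨n, ⟨x, hx, l, hl, hd⟩, hn⟩ :=
      ((h (ε / 4) (by positivity)).and_eventually (eventually_gt_atTop ⌈2 / ε⌉₊)).exists
    have hn' : 2 < n * ε := by
      rw [← div_lt_iff₀ hε]
      exact (Nat.le_ceil _).trans_lt (by exact_mod_cast hn)
    have hn0 : (0 : ℝ) < n := by exact_mod_cast (Nat.zero_le _).trans_lt hn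
    have key : ∀ B : Set (S × S), |‖res B (pathCnt x l)‖ - n * ‖res B (toL1 μ)‖| ≤ ε / 4 * n := by
      intro B
      have h1 := abs_norm_sub_norm_le (res B (pathCnt x l)) ((n : ℝ) • res B (toL1 μ))
      rw [norm_smul, Real.norm_natCast, ← map_smul, ← map_sub] at h1
      exact h1.trans ((norm_res_le _ _).trans hd.le)
    have k1 := abs_le.1 (key (A ×ˢ univ))
    have k2 := abs_le.1 (key (univ ×ˢ A))
    -- Departures from `A` and arrivals in `A` differ by at most one; with two approximation errors
    -- `ε / 4 * n` and `2 < n * ε`, the marginals differ by at most `ε`.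
    have k3 : |‖res (A ×ˢ univ) (pathCnt x l)‖ - ‖res (univ ×ˢ A) (pathCnt x l)‖| ≤ 1 := by
      have := norm_res_pathCnt_balance A x l
      rw [abs_le]
      split_ifs at this <;> constructor <;> linarith
    rw [abs_le] at k3
    have k4 : |(n : ℝ) * (a - b)| ≤ n * ε := by
      rw [abs_le]
      constructor <;> linarith [k1.1, k1.2, k2.1, k2.2, k3.1, k3.2]
    rw [abs_mul, Nat.abs_cast] at k4
    exact le_of_mul_le_mul_left k4 hn0

variable {Ω : Type*} [MeasurableSpace Ω] {β : PMF S} {P : Measure Ω} {X : ℕ → Ω → S}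

/-- For large `n` no possible path comes near `μ`, so some ball has probability exactly zero and the
rate is minus infinity rather than merely very negative. -/
theorem rlUpp_eq_bot (hX : IsMarkovChain p β P X) {μ : Measure (S × S)} [IsProbabilityMeasure μ]
    (hμ : μ ∉ admissibleBal p β) : rlUpp P X μ = ⊥ := by
  have h := mt mem_admissibleBal_of_approx hμ
  push Not at h
  obtain ⟨δ, hδ, h⟩ := h
  refine le_bot_iff.1 ((iInf_le _ (⟨δ / 2, half_pos hδ⟩ : Ioi (0 : ℝ))).trans ?_)
  refine limsup_le_of_le (by isBoundedDefault) ?_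
  filter_upwards [h, eventually_ne_atTop 0] with n hn hn0
  have h0 : P {ω | pairEmp X n ω ∈ tvBall μ (δ / 2)} = 0 := by
    refine le_antisymm ((hX.measure_tvBall_le μ _ hn0).trans (iSup₂_le fun x hx => ?_)) zero_le
    refine (pathMass_mono (B := ∅) fun l hl hw => ?_).trans (by simp [pathMass])
    have h1 := hn x hx l hw
    have h2 := hl.2
    rw [mul_div_cancel₀ _ two_ne_zero] at h2
    exact absurd h2 (not_lt.2 h1)
  rw [h0, ENNReal.log_zero]
  refine (EReal.bot_div_of_pos_ne_top ?_ (EReal.natCast_ne_top n)).le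
  exact_mod_cast Nat.pos_of_ne_zero hn0

end Admissibility

/-! ### Convex combinations and the sum of the class costs. -/

section Faces

variable {S : Type*} {p : S → PMF S} [MeasurableSpace S]

theorem chargedClasses_smul_add_smul_subset (a b : ℝ≥0) (μ ν : Measure (S × S)) :
    chargedClasses p (a • μ + b • ν) ⊆ chargedClasses p μ ∪ chargedClasses p ν := by
  rintro C ⟨hC, h⟩
  by_contra! hcon
  simp only [chargedClasses, mem_union, mem_ofPred_eq, hC, true_and, not_or, not_not] at hcon
  exact h (by simp [hcon.1, hcon.2])

variable [Countable S] [MeasurableSingletonClass S]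

theorem isProbabilityMeasure_smul_add_smul {ι : Type*} [MeasurableSpace ι] {a b : ℝ≥0}
    (hab : a + b = 1) (μ ν : Measure ι) [IsProbabilityMeasure μ] [IsProbabilityMeasure ν] :
    IsProbabilityMeasure (a • μ + b • ν) := by
  refine ⟨?_⟩
  rw [Measure.add_apply, Measure.smul_apply, Measure.smul_apply, measure_univ, measure_univ,
    ← add_smul, hab, one_smul]

/-- A combination charges only classes charged by `μ`, so it inherits total order and reachability
from `β`. Without a common `μ`, two admissible measures may charge incomparable classes. -/
theorem convex_face {β : PMF S} {μ : Measure (S × S)} (hμ : μ ∈ admissible p β) :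
    Convex ℝ≥0 {ν ∈ admissible p β | chargedClasses p ν ⊆ chargedClasses p μ} := by
  rintro ν₁ ⟨h₁, hc₁⟩ ν₂ ⟨h₂, hc₂⟩ a b - - hab
  have := h₁.1
  have := h₂.1
  have hsub : chargedClasses p (a • ν₁ + b • ν₂) ⊆ chargedClasses p μ :=
    (chargedClasses_smul_add_smul_subset a b ν₁ ν₂).trans (union_subset hc₁ hc₂)
  refine ⟨⟨isProbabilityMeasure_smul_add_smul hab ν₁ ν₂, ?_, fun C hC D hD =>
    hμ.2.2.1 C (hsub hC) D (hsub hD), fun C hC => hμ.2.2.2 C (hsub hC)⟩, hsub⟩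
  refine preAdmissible_of_reach fun z hz => ?_
  have key : ∀ ν ∈ admissible p β, ν {z} ≠ 0 → Reach p z.1 z.2 ∧ Reach p z.2 z.1 := by
    intro ν hν h0
    obtain ⟨C, -, hzC⟩ := hν.2.1.exists_class h0
    exact ⟨C.2.reach hzC.1 hzC.2, C.2.reach hzC.2 hzC.1⟩
  by_cases h0 : ν₁ {z} = 0
  · refine key ν₂ h₂ fun h0' => hz ?_
    simp [h0, h0']
  · exact key ν₁ h₁ h0

theorem classRateSum_smul_add_smul_le (a b : ℝ≥0) (μ ν : Measure (S × S)) [IsFiniteMeasure μ]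
    [IsFiniteMeasure ν] :
    classRateSum p (a • μ + b • ν) ≤ a * classRateSum p μ + b * classRateSum p ν := by
  simp only [classRateSum]
  rw [← ENNReal.tsum_mul_left, ← ENNReal.tsum_mul_left, ← ENNReal.tsum_add]
  refine ENNReal.tsum_le_tsum fun C => ?_
  rw [toL1_smul_add_smul, map_add, map_smul, map_smul, ← loopRate_smul C.reach_base,
    ← loopRate_smul C.reach_base]
  exact loopRate_add_le _ _ _

theorem res_sq_toL1_eq_zero {μ : Measure (S × S)} [IsFiniteMeasure μ] {C : IrredClass p}
    (hC : (C : Set S) ∉ chargedClasses p μ) : res C.sq (toL1 μ) = 0 := by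
  rw [← norm_eq_zero, norm_res_toL1, measureReal_eq_zero_iff]
  by_contra h
  exact hC ⟨C.2, h⟩

/-- In each class at most one of the two restrictions is nonzero, so only homogeneity of the cost is
used and equality holds. -/
theorem classRateSum_smul_add_smul_of_disjoint (a b : ℝ≥0) (μ ν : Measure (S × S))
    [IsFiniteMeasure μ] [IsFiniteMeasure ν]
    (h : Disjoint (chargedClasses p μ) (chargedClasses p ν)) :
    classRateSum p (a • μ + b • ν) = a * classRateSum p μ + b * classRateSum p ν := by
  simp only [classRateSum]
  rw [← ENNReal.tsum_mul_left, ← ENNReal.tsum_mul_left, ← ENNReal.tsum_add]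
  refine tsum_congr fun C => ?_
  rw [toL1_smul_add_smul, map_add, map_smul, map_smul]
  by_cases hC : (C : Set S) ∈ chargedClasses p μ
  · rw [res_sq_toL1_eq_zero (Set.disjoint_left.1 h hC), smul_zero, add_zero,
      loopRate_smul C.reach_base, loopRate_zero C.reach_base, mul_zero, add_zero]
  · rw [res_sq_toL1_eq_zero hC, smul_zero, zero_add, loopRate_smul C.reach_base,
      loopRate_zero C.reach_base, mul_zero, zero_add]

end Faces

/-! ### The rate function and the main statements. -/

section RateFunction

variable {S Ω : Type*} [MeasurableSpace S] [MeasurableSpace Ω] {P : Measure Ω} {X : ℕ → Ω → S}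

theorem rlLow_le_rlUpp (ν : Measure (S × S)) : rlLow P X ν ≤ rlUpp P X ν :=
  iInf_mono fun _ => liminf_le_limsup

theorem sLowFin_le_sLow (A : Set (Measure (S × S))) : sLowFin P X A ≤ sLow P X A :=
  iSup_le fun _ => liminf_le_liminf (.of_forall (log_div_mono P X inter_subset_left))

theorem sLowFin_mono {A B : Set (Measure (S × S))} (h : A ⊆ B) : sLowFin P X A ≤ sLowFin P X B :=
  iSup_mono fun _ =>
    liminf_le_liminf (.of_forall (log_div_mono P X (inter_subset_inter_left _ h)))

variable [Countable S] [MeasurableSingletonClass S] {p : S → PMF S} {β : PMF S}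

/-- This closes the chain: truncated rates are at most the lower rates, and these at most the upper
ones, so in the limit of small balls all three agree. -/
theorem rlUpp_le_sLowFin (hX : IsMarkovChain p β P X) (μ : Measure (S × S))
    [IsProbabilityMeasure μ] {δ : ℝ} (hδ : 0 < δ) : rlUpp P X μ ≤ sLowFin P X (tvBall μ δ) := by
  by_cases hμ : μ ∈ admissible p β
  · exact (rlUpp_le_neg_classRateSum hX hμ).trans (neg_classRateSum_le_sLowFin hX hμ hδ)
  · rw [rlUpp_eq_bot hX fun h => hμ h.1]
    exact bot_le

theorem rlLow_eq_rlUpp (hX : IsMarkovChain p β P X) (μ : Measure (S × S))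
    [IsProbabilityMeasure μ] : rlLow P X μ = rlUpp P X μ :=
  le_antisymm (rlLow_le_rlUpp μ) (le_iInf fun δ =>
    (rlUpp_le_sLowFin hX μ δ.2).trans (sLowFin_le_sLow _))

theorem rateI_eq_classRateSum (hX : IsMarkovChain p β P X) {μ : Measure (S × S)}
    (hμ : μ ∈ admissible p β) : rateI P X μ = (classRateSum p μ : EReal) := by
  have := hμ.1
  have h : rlLow P X μ = -(classRateSum p μ : EReal) :=
    le_antisymm ((rlLow_le_rlUpp μ).trans (rlUpp_le_neg_classRateSum hX hμ)) (le_iInf fun δ =>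
      (neg_classRateSum_le_sLowFin hX hμ δ.2).trans (sLowFin_le_sLow _))
  rw [rateI, h, neg_neg]

theorem tendsto_sLowFin (hX : IsMarkovChain p β P X) (μ : Measure (S × S))
    [IsProbabilityMeasure μ] :
    Tendsto (fun r : ℝ => sLowFin P X (tvBall μ r)) (𝓝[>] 0) (𝓝 (rlLow P X μ)) := by
  have hm : Monotone fun r : ℝ => sLowFin P X (tvBall μ r) :=
    fun _ _ h => sLowFin_mono (tvBall_mono μ h)
  have h := hm.tendsto_nhdsGT 0
  rw [sInf_image'] at h
  convert h using 2
  refine le_antisymm (le_iInf fun δ => ?_) (iInf_mono fun δ => sLowFin_le_sLow _)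
  rw [rlLow_eq_rlUpp hX]
  exact rlUpp_le_sLowFin hX μ δ.2

theorem rateI_smul_add_smul_le (hX : IsMarkovChain p β P X) (a b : ℝ≥0) {μ ν : Measure (S × S)}
    (hμ : μ ∈ admissible p β) (hν : ν ∈ admissible p β) (h : a • μ + b • ν ∈ admissible p β) :
    rateI P X (a • μ + b • ν)
      ≤ ((a : ℝ) : EReal) * rateI P X μ + ((b : ℝ) : EReal) * rateI P X ν := by
  have := hμ.1
  have := hν.1
  rw [rateI_eq_classRateSum hX hμ, rateI_eq_classRateSum hX hν, rateI_eq_classRateSum hX h]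
  refine (EReal.coe_ennreal_le_coe_ennreal_iff.2
    (classRateSum_smul_add_smul_le (p := p) a b μ ν)).trans_eq ?_
  push_cast
  rfl

theorem rateI_smul_add_smul_of_disjoint (hX : IsMarkovChain p β P X) (a b : ℝ≥0)
    {μ ν : Measure (S × S)} (hμ : μ ∈ admissible p β) (hν : ν ∈ admissible p β)
    (h : a • μ + b • ν ∈ admissible p β)
    (hd : Disjoint (chargedClasses p μ) (chargedClasses p ν)) :
    rateI P X (a • μ + b • ν)
      = ((a : ℝ) : EReal) * rateI P X μ + ((b : ℝ) : EReal) * rateI P X ν := by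
  have := hμ.1
  have := hν.1
  rw [rateI_eq_classRateSum hX hμ, rateI_eq_classRateSum hX hν, rateI_eq_classRateSum hX h,
    classRateSum_smul_add_smul_of_disjoint a b μ ν hd]
  push_cast
  rfl

end RateFunction

end PairLDP

end

theorem proposition2p4 {S Ω : Type*} [Countable S] [MeasurableSpace S]
    [MeasurableSingletonClass S] [MeasurableSpace Ω]
    (p : S → PMF S) (β : PMF S) (P : Measure Ω) [IsProbabilityMeasure P]
    (X : ℕ → Ω → S) (hX : IsMarkovChain p β P X) :
    -- the Ruelle-Lanford function exists, so that the rate function is well defined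
    (∀ ν : Measure (S × S), IsProbabilityMeasure ν → rlLow P X ν = rlUpp P X ν) ∧
    -- convexity on each face
    (∀ μ ∈ admissible p β,
      Convex ℝ≥0 {ν ∈ admissible p β | chargedClasses p ν ⊆ chargedClasses p μ} ∧
      ∀ ν₁ ∈ {ν ∈ admissible p β | chargedClasses p ν ⊆ chargedClasses p μ},
      ∀ ν₂ ∈ {ν ∈ admissible p β | chargedClasses p ν ⊆ chargedClasses p μ},
      ∀ a b : ℝ≥0, a + b = 1 →
        rateI P X (a • ν₁ + b • ν₂) ≤
          ((a : ℝ) : EReal) * rateI P X ν₁ + ((b : ℝ) : EReal) * rateI P X ν₂) ∧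
    -- the convexity inequality between admissible measures with an admissible combination
    (∀ a b : ℝ≥0, a + b = 1 → ∀ μ₁ ∈ admissible p β, ∀ μ₂ ∈ admissible p β,
      a • μ₁ + b • μ₂ ∈ admissible p β →
        rateI P X (a • μ₁ + b • μ₂) ≤
          ((a : ℝ) : EReal) * rateI P X μ₁ + ((b : ℝ) : EReal) * rateI P X μ₂) ∧
    -- affinity between measures that charge disjoint sets of classes
    (∀ a b : ℝ≥0, a + b = 1 → ∀ μ₁ ∈ admissible p β, ∀ μ₂ ∈ admissible p β,
      a • μ₁ + b • μ₂ ∈ admissible p β →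
      Disjoint (chargedClasses p μ₁) (chargedClasses p μ₂) →
        rateI P X (a • μ₁ + b • μ₂) =
          ((a : ℝ) : EReal) * rateI P X μ₁ + ((b : ℝ) : EReal) * rateI P X μ₂) ∧
    -- the rate function is infinite outside the balanced admissible measures
    (∀ μ : Measure (S × S), IsProbabilityMeasure μ → μ ∉ admissibleBal p β →
      rateI P X μ = ⊤) ∧
    -- approximation by finite subalphabets
    (∀ μ : Measure (S × S), IsProbabilityMeasure μ →
      MonotoneOn (fun r : ℝ => sLowFin P X (tvBall μ r)) (Ioi 0) ∧
      Tendsto (fun r : ℝ => sLowFin P X (tvBall μ r)) (𝓝[>] 0) (𝓝 (-rateI P X μ))) := by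
  refine ⟨fun ν _ => rlLow_eq_rlUpp hX ν, fun μ hμ => ⟨convex_face hμ, ?_⟩, ?_, ?_, ?_, ?_⟩
  -- On a face the combination is automatically admissible, so this is a case of the general
  -- inequality.
  · exact fun ν₁ h₁ ν₂ h₂ a b hab => rateI_smul_add_smul_le hX a b h₁.1 h₂.1
      (convex_face hμ h₁ h₂ zero_le zero_le hab).1
  · exact fun a b _ μ₁ h₁ μ₂ h₂ h => rateI_smul_add_smul_le hX a b h₁ h₂ h
  · exact fun a b _ μ₁ h₁ μ₂ h₂ h hd => rateI_smul_add_smul_of_disjoint hX a b h₁ h₂ h hd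
  · intro μ _ hμ
    rw [rateI, rlLow_eq_rlUpp hX, rlUpp_eq_bot hX hμ, EReal.neg_bot]
  · intro μ _
    refine ⟨fun _ _ _ _ h => sLowFin_mono (tvBall_mono μ h), ?_⟩
    rw [rateI, neg_neg]
    exact tendsto_sLowFin hX μ
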